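/- **Definitions.** A *generalized semi-Markov process* (GSMP) consists of a finite set $S$ of states, a finite set $\mathcal E$ of events, a nonempty set $\mathbf E(s)\subseteq\mathcal E$ of events scheduled in each state $s$, a distribution $\mathrm{Succ}(s,E)$ on $S$ for each state $s$ and set $E$ of events, and an initial distribution on $S$. Each event $e$ has bounds $\ell_e\in\{0,1,2,\dots\}$ and $u_e\in\{1,2,\dots\}\cup\{\infty\}$ with $\ell_e\le u_e$. If $\ell_e=u_e$, then $e$ is a *fixed-delay* event, with delay equal to $\ell_e$. If $\ell_e<u_e$, then $e$ is a *variable-delay* event; its delay has finite mean and a density that is continuous and positive on $[\ell_e,u_e]$ (on $[\ell_e,\infty)$ if $u_e=\infty$) and zero elsewhere. A *configuration* consists of a state $s$, the time $\nu(e)\ge 0$ elapsed since $e$ was scheduled for every $e\in\mathbf E(s)$, and the time $\nu(\vartriangle)\ge 0$ spent in the previous configuration. The GSMP induces a Markov chain on configurations. It starts in a random initial state with all times equal to $0$. In one step from $(s,\nu)$, each $e\in\mathbf E(s)$ independently receives a remaining time distributed as $X_e-\nu(e)$ conditioned on $X_e>\nu(e)$, where $X_e$ is the delay of $e$ (the remaining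 time is $0$ if $X_e>\nu(e)$ has probability zero). Let $t$ be the least remaining time and $E$ the set of events attaining it. The chain moves to a state $s'$ drawn from $\mathrm{Succ}(s,E)$. The events of $(\mathbf E(s)\cap\mathbf E(s'))\setminus E$ become older by $t$, all other events of $\mathbf E(s')$ get $\nu'(e)=0$, and $\nu'(\vartriangle)=t$. A *run* is a sequence $\sigma=(s_0,\nu_0)(s_1,\nu_1)\cdots$ of configurations; the chain defines a probability measure on runs. For a set $H\subseteq S$ let $\delta_H(s)=1$ if $s\in H$ and $\delta_H(s)=0$ otherwise, and put $$\mathbf d_H(\sigma)=\lim_{n\to\infty}\frac{\sum_{i=0}^n\delta_H(s_i)}{n},\qquad \mathbf c_H(\sigma)=\lim_{n\to\infty}\frac{\sum_{i=0}^n\delta_H(s_i)\,\nu_{i+1}(\vartriangle)}{\sum_{i=0}^n\nu_{i+1}(\vartriangle)}.$$ Each is *well-defined* on $\sigma$ if the limit exists. A *phase* in $H$ is a maximal finite nonempty block of consecutive configurations of $\sigma$ with states in $H$, and its length is the number of configurations in it. **Theorem.** There are a GSMP with exactly three events, two of them fixed-delay events and the third a variable-delay event with uniform distribution on a bounded interval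 $[\ell,u]$, and a set $H\subseteq S$ of its states (the "1-states"), with the following properties. 1. There are a single state $\mathring s\in H$, a constant $\alpha>0$ and a measurable set $\mathcal R$ of runs of positive probability such that for every $\sigma\in\mathcal R$: - neither the discrete frequency $\mathbf d_H(\sigma)$ nor the timed frequency $\mathbf c_H(\sigma)$ of the 1-states is well-defined; - neither $\mathbf d_{\{\mathring s\}}(\sigma)$ nor $\mathbf c_{\{\mathring s\}}(\sigma)$ is well-defined; - infinitely many phases in $H$, and infinitely many phases in $S\setminus H$, are at least $\alpha$ times as long as the whole part of the run that precedes them. 2. The Markov chain of this GSMP on the set of all configurations has no invariant probability measure. -/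

import Mathlib

open MeasureTheory ProbabilityTheory Filter Topology Set
open scoped ENNReal NNReal

noncomputable section

/-- A generalized semi-Markov process with state set `S` and event set `E`, together with the
delay data of its events. -/
structure GSMP (S E : Type) [Fintype S] [Fintype E] where
  /-- lower bound `ℓ_e ∈ {0, 1, 2, …}` of the delay of the event `e` -/
  lower : E → ℕ
  /-- upper bound `u_e ∈ {1, 2, …} ∪ {∞}` of the delay of the event `e` -/
  upper : E → ℕ∞
  upper_ne_zero : ∀ e, upper e ≠ 0
  lower_le_upper : ∀ e, (lower e : ℕ∞) ≤ upper e
  /-- density of the delay of a variable-delay event; it plays no role for fixed-delay events -/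
  density : E → ℝ → ℝ
  /-- the density is continuous on `[ℓ_e, u_e]` (on `[ℓ_e, ∞)` if `u_e = ∞`) … -/
  density_continuousOn : ∀ e, (lower e : ℕ∞) < upper e →
    ContinuousOn (density e) {x : ℝ | (lower e : ℝ) ≤ x ∧ ∀ m : ℕ, upper e = m → x ≤ m}
  /-- … positive there … -/
  density_pos : ∀ e, (lower e : ℕ∞) < upper e →
    ∀ x ∈ {x : ℝ | (lower e : ℝ) ≤ x ∧ ∀ m : ℕ, upper e = m → x ≤ m}, 0 < density e x
  /-- … zero elsewhere … -/
  density_zero : ∀ e, (lower e : ℕ∞) < upper e →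
    ∀ x ∉ {x : ℝ | (lower e : ℝ) ≤ x ∧ ∀ m : ℕ, upper e = m → x ≤ m}, density e x = 0
  /-- … has total mass one … -/
  density_integral : ∀ e, (lower e : ℕ∞) < upper e → ∫ x, density e x = 1
  /-- … and finite expectation. -/
  density_mean : ∀ e, (lower e : ℕ∞) < upper e → Integrable (fun x => x * density e x)
  /-- the nonempty set of events scheduled in a state -/
  sched : S → Finset E
  sched_nonempty : ∀ s, (sched s).Nonempty
  /-- the distribution of the successor state, given the state and the set of events that occur -/
  succ : S → Finset E → PMF S
  /-- the initial distribution -/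
  init : PMF S

namespace GSMP

section Basic

variable {S E : Type} [Fintype S] [Fintype E] (G : GSMP S E)

/-- `e` is a fixed-delay event. -/
def IsFixed (e : E) : Prop := (G.lower e : ℕ∞) = G.upper e

/-- `e` is a variable-delay event. -/
def IsVariable (e : E) : Prop := (G.lower e : ℕ∞) < G.upper e

/-- `e` is a variable-delay event whose delay is uniform on a bounded interval `[ℓ_e, u_e]`. -/
def IsUniform (e : E) : Prop :=
  G.IsVariable e ∧ ∃ m : ℕ, G.upper e = m ∧
    ∀ x ∈ Icc (G.lower e : ℝ) m, G.density e x = 1 / ((m : ℝ) - G.lower e)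

/-- Configurations: a state, the time elapsed since each scheduled event was scheduled, and the
time spent in the previous configuration. Events that are not scheduled have no age; the
placeholder `0` is stored for them. -/
def Config : Type :=
  {z : S × (E → ℝ≥0) × ℝ≥0 // ∀ e ∉ G.sched z.1, z.2.1 e = 0}

namespace Config

variable {G}

/-- The state of a configuration. -/
def state (z : G.Config) : S := z.1.1

/-- The time elapsed since the event `e` was scheduled (`0` if it is not scheduled). -/
def age (z : G.Config) (e : E) : ℝ≥0 := z.1.2.1 e

/-- The amount of time spent in the previous configuration. -/
def last (z : G.Config) : ℝ≥0 := z.1.2.2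

end Config

/-- The law of the delay of an event. -/
def delayLaw (e : E) : Measure ℝ :=
  open Classical in
  if (G.lower e : ℕ∞) < G.upper e then
    volume.withDensity (fun x => ENNReal.ofReal (G.density e x))
  else Measure.dirac (G.lower e : ℝ)

/-- The law of the remaining time of an event `e` that was scheduled `a` time units ago: the
conditional law of `X - a` given `X > a`, where `X` is the delay of `e`. In an overdue
configuration, where `X > a` is impossible, the event occurs immediately. (From the initial
configurations such configurations are reached with probability zero.) -/
def residualLaw (e : E) (a : ℝ≥0) : Measure ℝ≥0 :=
  open Classical in
  if G.delayLaw e (Ioi (a : ℝ)) = 0 then Measure.dirac 0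
  else ((G.delayLaw e)[|Ioi (a : ℝ)]).map (fun x : ℝ => (x - (a : ℝ)).toNNReal)

/-- The time at which the first scheduled event occurs, when `x e` is the remaining time of `e`. -/
def firstTime (s : S) (x : E → ℝ≥0) : ℝ≥0 := (G.sched s).inf' (G.sched_nonempty s) x

/-- The set of scheduled events that occur first, when `x e` is the remaining time of `e`. -/
def winners (s : S) (x : E → ℝ≥0) : Finset E :=
  open Classical in (G.sched s).filter (fun e => x e = G.firstTime s x)

/-- The configuration after the events `W` have occurred in `z` at time `t` and the process has
moved to `s'`: inherited events (scheduled in both states, not in `W`) have become older by `t`,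
new events have age `0`, and the other old events are discarded. -/
def next (z : G.Config) (t : ℝ≥0) (W : Finset E) (s' : S) : G.Config :=
  open Classical in
  ⟨(s', (fun e => if e ∈ G.sched s' ∧ e ∈ G.sched z.state ∧ e ∉ W then z.age e + t else 0), t), by
    intro e he
    simp_all⟩

/-- The initial configuration in the state `s`, with zero valuation. -/
def zeroConfig (s : S) : G.Config := ⟨(s, fun _ => 0, 0), fun _ _ => rfl⟩

end Basic

section Laws

variable {S E : Type} [Fintype S] [Fintype E] (G : GSMP S E)

instance isProbabilityMeasure_delayLaw (e : E) : IsProbabilityMeasure (G.delayLaw e) := by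
  unfold delayLaw
  split_ifs with h
  · constructor
    rw [withDensity_apply _ MeasurableSet.univ, Measure.restrict_univ,
      ← ofReal_integral_eq_lintegral_ofReal, G.density_integral e h, ENNReal.ofReal_one]
    · by_contra hn
      have := G.density_integral e h
      rw [integral_undef hn] at this
      exact zero_ne_one this
    · refine Eventually.of_forall fun x => ?_
      by_cases hx : x ∈ {x : ℝ | (G.lower e : ℝ) ≤ x ∧ ∀ m : ℕ, G.upper e = m → x ≤ m}
      · exact (G.density_pos e h x hx).le
      · exact (G.density_zero e h x hx).ge
  · infer_instance

instance isProbabilityMeasure_residualLaw (e : E) (a : ℝ≥0) :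
    IsProbabilityMeasure (G.residualLaw e a) := by
  unfold residualLaw
  split_ifs with h
  · infer_instance
  · have := cond_isProbabilityMeasure (μ := G.delayLaw e) h
    exact Measure.isProbabilityMeasure_map (by fun_prop)

theorem measurable_residualLaw (e : E) : Measurable (G.residualLaw e) := by
  refine Measure.measurable_of_measurable_coe _ fun B hB => ?_
  have h1 : Measurable fun a : ℝ≥0 => G.delayLaw e (Ioi (a : ℝ)) :=
    measurable_measure_prodMk_left (s := {p : ℝ≥0 × ℝ | (p.1 : ℝ) < p.2})
      (measurableSet_lt (by fun_prop) (by fun_prop))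
  have h2 : Measurable fun a : ℝ≥0 =>
      G.delayLaw e (Ioi (a : ℝ) ∩ (fun x : ℝ => (x - a).toNNReal) ⁻¹' B) := by
    refine measurable_measure_prodMk_left
      (s := {p : ℝ≥0 × ℝ | (p.1 : ℝ) < p.2} ∩ (fun p => (p.2 - p.1).toNNReal) ⁻¹' B)
      ((measurableSet_lt (by fun_prop) (by fun_prop)).inter ?_)
    exact (show Measurable fun p : ℝ≥0 × ℝ => (p.2 - p.1).toNNReal by fun_prop) hB
  have h3 : (fun a => G.residualLaw e a B) = fun a : ℝ≥0 =>
      open Classical in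
      if G.delayLaw e (Ioi (a : ℝ)) = 0 then Measure.dirac (0 : ℝ≥0) B
      else (G.delayLaw e (Ioi (a : ℝ)))⁻¹ *
        G.delayLaw e (Ioi (a : ℝ) ∩ (fun x : ℝ => (x - a).toNNReal) ⁻¹' B) := by
    funext a
    unfold residualLaw
    split_ifs with h
    · rfl
    · rw [Measure.map_apply (by fun_prop) hB, cond_apply measurableSet_Ioi]
  rw [h3]
  exact Measurable.ite (h1 (measurableSet_singleton 0)) measurable_const (h1.inv.mul h2)

end Laws

section Config

variable {S E : Type} [Fintype S] [Fintype E] [MeasurableSpace S] (G : GSMP S E)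

instance : MeasurableSpace G.Config :=
  inferInstanceAs (MeasurableSpace {z : S × (E → ℝ≥0) × ℝ≥0 // ∀ e ∉ G.sched z.1, z.2.1 e = 0})

theorem measurable_state : Measurable (Config.state : G.Config → S) :=
  measurable_fst.comp measurable_subtype_coe

theorem measurable_age (e : E) : Measurable (fun z : G.Config => z.age e) :=
  (measurable_pi_apply e).comp
    (measurable_fst.comp (measurable_snd.comp measurable_subtype_coe))

theorem measurable_last : Measurable (Config.last : G.Config → ℝ≥0) :=
  measurable_snd.comp (measurable_snd.comp measurable_subtype_coe)

end Config

section Dynamics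

variable {S E : Type} [Fintype S] [Fintype E] [MeasurableSpace S] [DiscreteMeasurableSpace S]
  (G : GSMP S E)

/-- The joint law of the remaining times of the events, which are independent. The coordinates of
events that are not scheduled are never used. -/
def race : Kernel G.Config (E → ℝ≥0) where
  toFun z := Measure.pi fun e => G.residualLaw e (z.age e)
  measurable' := by
    refine Measurable.measure_of_isPiSystem_of_isProbabilityMeasure generateFrom_pi.symm
      isPiSystem_pi ?_
    rintro _ ⟨B, hB, rfl⟩
    simp only [Measure.pi_pi]
    refine Finset.measurable_prod _ fun e _ => ?_
    exact (Measure.measurable_coe (show MeasurableSet (B e) from hB e (mem_univ e))).comp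
      ((G.measurable_residualLaw e).comp (G.measurable_age e))

instance : IsMarkovKernel G.race := by
  constructor
  intro z
  change IsProbabilityMeasure (Measure.pi fun e => G.residualLaw e (z.age e))
  infer_instance

theorem measurable_firstTime : Measurable fun p : G.Config × (E → ℝ≥0) =>
    G.firstTime p.1.state p.2 := by
  have h : Measurable fun q : S × (E → ℝ≥0) => G.firstTime q.1 q.2 := by
    refine measurable_from_prod_countable_right fun s => ?_
    have : (fun x => G.firstTime s x) =
        (G.sched s).inf' (G.sched_nonempty s) (fun e (x : E → ℝ≥0) => x e) := by
      funext x
      rw [Finset.inf'_apply]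
      rfl
    change Measurable (fun x => G.firstTime s x)
    rw [this]
    exact Finset.inf'_induction _ _ (fun _ h1 _ h2 => h1.inf h2)
      (fun e _ => measurable_pi_apply e)
  exact h.comp ((G.measurable_state.comp measurable_fst).prodMk measurable_snd)

theorem measurableSet_mem_winners (e : E) :
    MeasurableSet {p : G.Config × (E → ℝ≥0) | e ∈ G.winners p.1.state p.2} := by
  have : {p : G.Config × (E → ℝ≥0) | e ∈ G.winners p.1.state p.2} =
      {p | p.1.state ∈ {s | e ∈ G.sched s}} ∩ {p | p.2 e = G.firstTime p.1.state p.2} := by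
    ext p
    simp [winners]
  rw [this]
  refine MeasurableSet.inter ?_ (measurableSet_eq_fun (by fun_prop) G.measurable_firstTime)
  exact (G.measurable_state.comp measurable_fst) (MeasurableSet.of_discrete)

theorem measurableSet_winners_eq (W : Finset E) :
    MeasurableSet {p : G.Config × (E → ℝ≥0) | G.winners p.1.state p.2 = W} := by
  have : {p : G.Config × (E → ℝ≥0) | G.winners p.1.state p.2 = W} =
      ⋂ e, {p | e ∈ G.winners p.1.state p.2 ↔ e ∈ W} := by
    ext p
    simp [Finset.ext_iff]
  rw [this]
  refine MeasurableSet.iInter fun e => ?_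
  exact MeasurableSet.iff (G.measurableSet_mem_winners e) (MeasurableSet.const _)

theorem measurable_next (s' : S) : Measurable fun p : G.Config × (E → ℝ≥0) =>
    G.next p.1 (G.firstTime p.1.state p.2) (G.winners p.1.state p.2) s' := by
  refine Measurable.subtype_mk ?_
  refine measurable_const.prodMk (Measurable.prodMk ?_ G.measurable_firstTime)
  refine measurable_pi_lambda _ fun e => ?_
  refine Measurable.ite ?_ ?_ measurable_const
  · refine (MeasurableSet.const _).inter (MeasurableSet.inter ?_ ?_)
    · exact (G.measurable_state.comp measurable_fst)
        (MeasurableSet.of_discrete (s := {s | e ∈ G.sched s}))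
    · exact (G.measurableSet_mem_winners e).compl
  · exact ((G.measurable_age e).comp measurable_fst).add G.measurable_firstTime

/-- Given a configuration and the remaining times of the events, let the first events occur, choose
the successor state, and update the valuation. -/
def jump : Kernel (G.Config × (E → ℝ≥0)) G.Config where
  toFun p := ((G.succ p.1.state (G.winners p.1.state p.2)).toMeasure).map
    (G.next p.1 (G.firstTime p.1.state p.2) (G.winners p.1.state p.2))
  measurable' := by
    refine Measure.measurable_of_measurable_coe _ fun B hB => ?_
    have h : (fun p : G.Config × (E → ℝ≥0) =>
        ((G.succ p.1.state (G.winners p.1.state p.2)).toMeasure).map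
          (G.next p.1 (G.firstTime p.1.state p.2) (G.winners p.1.state p.2)) B) =
        fun p => ∑ s', ∑ s : S, ∑ W : Finset E,
          ({p | p.1.state = s} ∩ {p : G.Config × (E → ℝ≥0) | G.winners p.1.state p.2 = W} ∩
            {p | G.next p.1 (G.firstTime p.1.state p.2) (G.winners p.1.state p.2) s' ∈ B}).indicator
          (fun _ => G.succ s W s') p := by
      classical
      funext p
      rw [Measure.map_apply (measurable_of_countable _) hB, PMF.toMeasure_apply_fintype]
      refine Finset.sum_congr rfl fun s' _ => ?_
      rw [Finset.sum_eq_single p.1.state, Finset.sum_eq_single (G.winners p.1.state p.2)]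
      · simp [indicator_apply]
      · intro W _ hW
        simp [hW.symm]
      · simp
      · intro s _ hs
        simp [hs.symm]
      · simp
    rw [h]
    refine Finset.measurable_sum _ fun s' _ => Finset.measurable_sum _ fun s _ =>
      Finset.measurable_sum _ fun W _ => measurable_const.indicator ?_
    refine MeasurableSet.inter (MeasurableSet.inter ?_ (G.measurableSet_winners_eq W)) ?_
    · exact (G.measurable_state.comp measurable_fst) (measurableSet_singleton s)
    · exact G.measurable_next s' hB

instance : IsMarkovKernel G.jump := by
  constructor
  intro p
  exact Measure.isProbabilityMeasure_map
    (μ := (G.succ p.1.state (G.winners p.1.state p.2)).toMeasure)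
    (measurable_of_countable _).aemeasurable

/-- The one-step transition kernel `P` on configurations. -/
def step : Kernel G.Config G.Config := G.jump ∘ₖ (Kernel.id ×ₖ G.race)

instance : IsMarkovKernel G.step := by unfold step; infer_instance

/-- The initial measure on configurations. -/
def initMeasure : Measure G.Config := G.init.toMeasure.map G.zeroConfig

instance : IsProbabilityMeasure G.initMeasure :=
  Measure.isProbabilityMeasure_map (measurable_of_countable _).aemeasurable

/-- The law of the run `z₀ z₁ z₂ …` of the Markov chain with initial measure `initMeasure` and
transition kernel `step`. -/
def runMeasure : Measure (ℕ → G.Config) :=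
  Kernel.trajMeasure (X := fun _ => G.Config) G.initMeasure
    (fun n => G.step.comap (fun h => h ⟨n, Finset.mem_Iic.mpr le_rfl⟩) (measurable_pi_apply _))

instance : IsProbabilityMeasure G.runMeasure := by unfold runMeasure; infer_instance

end Dynamics

section Frequency

variable {S E : Type} [Fintype S] [Fintype E] {G : GSMP S E}

/-- The discrete frequency `d` of the set `H` of states is well-defined on the run `σ`. -/
def DiscreteFreqDefined (H : Set S) (σ : ℕ → G.Config) : Prop :=
  ∃ r : ℝ, Tendsto (fun n : ℕ =>
    (∑ i ∈ Finset.range (n + 1), H.indicator (fun _ => (1 : ℝ)) (σ i).state) / n) atTop (𝓝 r)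

/-- The timed frequency `c` of the set `H` of states is well-defined on the run `σ`; the time
spent in the `i`-th configuration is stored in the `(i+1)`-st one. -/
def TimedFreqDefined (H : Set S) (σ : ℕ → G.Config) : Prop :=
  ∃ r : ℝ, Tendsto (fun n : ℕ =>
    (∑ i ∈ Finset.range (n + 1), H.indicator (fun _ => (1 : ℝ)) (σ i).state * (σ (i + 1)).last) /
      ∑ i ∈ Finset.range (n + 1), ((σ (i + 1)).last : ℝ)) atTop (𝓝 r)

/-- The configurations `σ a, …, σ (b - 1)` form a phase in `H`: a maximal nonempty block of
consecutive configurations whose states lie in `H`. -/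
def IsPhase (H : Set S) (σ : ℕ → G.Config) (a b : ℕ) : Prop :=
  a < b ∧ (∀ i, a ≤ i → i < b → (σ i).state ∈ H) ∧ (σ b).state ∉ H ∧
    ∀ j, j + 1 = a → (σ j).state ∉ H

/-- Infinitely often on the run `σ`, a single phase in `H` has at least `α` times the length of
everything that precedes it. -/
def InfinitelyManyLongPhases (H : Set S) (α : ℝ) (σ : ℕ → G.Config) : Prop :=
  ∀ N : ℕ, ∃ a b : ℕ, N ≤ a ∧ IsPhase H σ a b ∧ α * a ≤ (b : ℝ) - a

end Frequency

end GSMP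

end

/-! Events 0 and 1 have delay 2, event 2 has a uniform delay X on [1, 2]. Apart from a short initial
phase, a run consists of rounds. A round starts in `ready b` when event 0 occurs; at that moment
event 1 has some age d, the shift, with 0 < d < 1, and X is drawn afresh. Event 1 is due at time 2 -
d of the round. If X < 2 - d, event 1 is renewed on time and the next round again has shift d and
bit b. If X > 2 - d, event 1 is held back until time X, so that the next shift is 2 - X < d, and the
bit flips. Hence almost surely every round takes three steps and two time units, the shift is the
running minimum of the variables 2 - X, and the bit flips exactly when a new minimum appears
(`Regular.round`, `RegularWith.bit_succ`).

The chain redraws residual times at every step, but a delay that has survived to age a, continued by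
a residual time, is again uniform (`uniformLaw_split`). So the delays of the rounds are independent
(`runMeasure_delays`), and the flips are records of an independent uniform sequence. For m = 4l,
with probability at least 2^(-24), the minimum falls below 2/m at a round i in [m, 2m), below 1/m at
a round j in [3m, 4m), and no other round up to 6m gives a value below 2/m
(`le_runMeasure_twoRecords`). Then the bit is constant on [i, j) and takes the opposite value on [j,
6m], two blocks comparable in length with their past. By continuity from above this happens for
infinitely many l with positive probability. Such runs have long phases of both kinds, and every
frequency oscillates (`not_tendsto_div_of_blocks`).

Invariant measures are excluded because the shift never increases and can become smaller than any q
> 0. The configurations with shift less than q form an absorbing set, reached with positive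
probability from every configuration, so an invariant probability measure is carried by it
(`ae_close`). This holds for every q, but a shift is positive, so the intersection of these sets is
empty (`exists_notMem_close`). -/

noncomputable section

namespace GSMP

/-! ### The filtration of a run and its Markov property -/

section Past

variable {S E : Type} [Fintype S] [Fintype E] [MeasurableSpace S] (G : GSMP S E)

/-- The events that are determined by the first configurations of a run, up to index `n`. -/
abbrev past (n : ℕ) : MeasurableSpace (ℕ → G.Config) :=
  MeasurableSpace.comap (Preorder.frestrictLe (π := fun _ => G.Config) n) inferInstance

theorem past_le (n : ℕ) : G.past n ≤ MeasurableSpace.pi :=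
  (Preorder.measurable_frestrictLe (X := fun _ => G.Config) n).comap_le

theorem measurable_eval_past {k n : ℕ} (h : k ≤ n) :
    Measurable[G.past n] fun σ : ℕ → G.Config => σ k := by
  intro B hB
  exact ⟨(fun f => f ⟨k, Finset.mem_Iic.mpr h⟩) ⁻¹' B, measurable_pi_apply _ hB, rfl⟩

theorem past_mono {k n : ℕ} (h : k ≤ n) : G.past k ≤ G.past n := by
  rintro _ ⟨A, hA, rfl⟩
  refine ⟨(Preorder.frestrictLe₂ (π := fun _ => G.Config) h) ⁻¹' A,
    Preorder.measurable_frestrictLe₂ (X := fun _ => G.Config) h hA, rfl⟩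

end Past

section Chain

variable {S E : Type} [Fintype S] [Fintype E] [MeasurableSpace S] [DiscreteMeasurableSpace S]
  (G : GSMP S E)

/-- The Markov property of the run measure, for one step. -/
theorem setLIntegral_runMeasure_succ (n : ℕ) {A : Set (Π _ : Finset.Iic n, G.Config)}
    (hA : MeasurableSet A) {g : G.Config → G.Config → ℝ≥0∞}
    (hg : Measurable (Function.uncurry g)) :
    ∫⁻ σ in Preorder.frestrictLe (π := fun _ => G.Config) n ⁻¹' A, g (σ n) (σ (n + 1)) ∂G.runMeasure =
      ∫⁻ σ in Preorder.frestrictLe (π := fun _ => G.Config) n ⁻¹' A,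
        ∫⁻ w, g (σ n) w ∂G.step (σ n) ∂G.runMeasure := by
  set κ : (n : ℕ) → Kernel (Π _ : Finset.Iic n, G.Config) G.Config := fun n =>
    G.step.comap (fun h => h ⟨n, Finset.mem_Iic.mpr le_rfl⟩) (measurable_pi_apply _) with hκ
  have hr : Measurable (Preorder.frestrictLe (π := fun _ : ℕ => G.Config) n) :=
    Preorder.measurable_frestrictLe n
  have key : (G.runMeasure.map (Preorder.frestrictLe n)) ⊗ₘ κ n =
      G.runMeasure.map (fun x => (Preorder.frestrictLe n x, x (n + 1))) :=
    Kernel.map_frestrictLe_trajMeasure_compProd_eq_map_trajMeasure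
  have hf : Measurable fun p : (Π _ : Finset.Iic n, G.Config) × G.Config =>
      g (p.1 ⟨n, Finset.mem_Iic.mpr le_rfl⟩) p.2 :=
    hg.comp (f := fun p : (Π _ : Finset.Iic n, G.Config) × G.Config =>
      (p.1 ⟨n, Finset.mem_Iic.mpr le_rfl⟩, p.2)) (by fun_prop)
  have h1 := Measure.setLIntegral_compProd (μ := G.runMeasure.map (Preorder.frestrictLe n))
    (κ := κ n) hf hA MeasurableSet.univ
  rw [key, setLIntegral_map (hA.prod MeasurableSet.univ) hf (by fun_prop),
    setLIntegral_map hA (by exact Measurable.lintegral_kernel_prod_right' (κ := (κ n).restrict MeasurableSet.univ) hf) hr] at h1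
  have h2 : (fun x : ℕ → G.Config => (Preorder.frestrictLe (π := fun _ => G.Config) n x, x (n + 1))) ⁻¹'
      (A ×ˢ univ) = Preorder.frestrictLe (π := fun _ => G.Config) n ⁻¹' A := by
    ext; simp
  rw [h2] at h1
  simpa [κ] using h1

theorem runMeasure_map_zero : G.runMeasure.map (fun σ => σ 0) = G.initMeasure := by
  set e : (Π _ : Finset.Iic 0, G.Config) → G.Config :=
    fun h => h ⟨0, Finset.mem_Iic.mpr le_rfl⟩ with he
  have hm : Measurable e := measurable_pi_apply _
  have h0 : (fun σ : ℕ → G.Config => σ 0) =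
      e ∘ Preorder.frestrictLe (π := fun _ => G.Config) 0 := rfl
  rw [h0, ← Measure.map_map hm (Preorder.measurable_frestrictLe 0),
    runMeasure, Kernel.trajMeasure, Measure.map_comp _ _ (by fun_prop),
    Kernel.traj_map_frestrictLe, Kernel.partialTraj_self, Measure.id_comp,
    Measure.map_map hm (by fun_prop)]
  exact Measure.map_id

theorem setLIntegral_past_succ {n : ℕ} {A : Set (ℕ → G.Config)} (hA : MeasurableSet[G.past n] A)
    {g : G.Config → G.Config → ℝ≥0∞} (hg : Measurable (Function.uncurry g)) :
    ∫⁻ σ in A, g (σ n) (σ (n + 1)) ∂G.runMeasure =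
      ∫⁻ σ in A, ∫⁻ w, g (σ n) w ∂G.step (σ n) ∂G.runMeasure := by
  obtain ⟨A, hA, rfl⟩ := hA
  exact G.setLIntegral_runMeasure_succ n hA hg

/-- Since `P` is only required almost surely at time n, this carries support statements along a run
by induction. -/
theorem ae_runMeasure_succ {n : ℕ} {P : G.Config → Prop} {Q : G.Config → G.Config → Prop}
    (hP : ∀ᵐ σ ∂G.runMeasure, P (σ n)) (hQ : MeasurableSet {p : G.Config × G.Config | Q p.1 p.2})
    (h : ∀ z, P z → ∀ᵐ w ∂G.step z, Q z w) :
    ∀ᵐ σ ∂G.runMeasure, Q (σ n) (σ (n + 1)) := by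
  have hg : Measurable (Function.uncurry fun z w : G.Config =>
      {p : G.Config × G.Config | Q p.1 p.2}ᶜ.indicator (fun _ => (1 : ℝ≥0∞)) (z, w)) :=
    measurable_const.indicator hQ.compl
  have key := G.setLIntegral_past_succ (n := n) (A := univ) MeasurableSet.univ hg
  rw [setLIntegral_univ, setLIntegral_univ] at key
  have h0 : ∫⁻ σ, ∫⁻ w, {p : G.Config × G.Config | Q p.1 p.2}ᶜ.indicator
      (fun _ => (1 : ℝ≥0∞)) (σ n, w) ∂G.step (σ n) ∂G.runMeasure = 0 := by
    refine lintegral_eq_zero_of_ae_eq_zero ?_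
    filter_upwards [hP] with σ hσ
    refine lintegral_eq_zero_of_ae_eq_zero ?_
    filter_upwards [h _ hσ] with w hw
    simp [hw]
  have hgσ : Measurable fun σ : ℕ → G.Config =>
      {p : G.Config × G.Config | Q p.1 p.2}ᶜ.indicator (fun _ => (1 : ℝ≥0∞)) (σ n, σ (n + 1)) :=
    hg.comp (f := fun σ : ℕ → G.Config => (σ n, σ (n + 1))) (by fun_prop)
  rw [h0, lintegral_eq_zero_iff hgσ] at key
  filter_upwards [key] with σ hσ
  by_contra hn
  simp [hn] at hσ

/-- If an invariant measure charges only points of `Y` that belong to the absorbing set `D`, then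
the same is true of every set from which `Y ∪ D` is reached with positive probability. -/
theorem ae_mem_of_step_ne_zero {π : Measure G.Config} [IsProbabilityMeasure π]
    (hπ : Kernel.Invariant G.step π) {D Y Z : Set G.Config} (hD : MeasurableSet D)
    (hDD : ∀ z ∈ D, ∀ᵐ w ∂G.step z, w ∈ D)
    (hY : ∀ᵐ z ∂π, z ∈ Y → z ∈ D) (hZ : ∀ z ∈ Z, G.step z (Y ∪ D) ≠ 0) :
    ∀ᵐ z ∂π, z ∈ Z → z ∈ D := by
  -- By invariance, a null set is almost surely not entered in one step.
  have h1 : ∀ᵐ z ∂π, ∀ᵐ w ∂G.step z, w ∈ Y → w ∈ D := by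
    rw [← hπ.def] at hY
    exact Measure.ae_ae_of_ae_bind G.step.measurable.aemeasurable hY
  -- Mass balance: the absorbing set already retains all of its own mass, so invariance leaves no
  -- room for an inflow from its complement.
  have h2 : ∀ᵐ z ∂π, z ∈ Dᶜ → G.step z D = 0 := by
    have hm : Measurable fun z => G.step z D := G.step.measurable_coe hD
    have e1 : ∫⁻ z, G.step z D ∂π = π D := by
      conv_rhs => rw [← hπ.def]
      rw [Measure.bind_apply hD G.step.measurable.aemeasurable]
    rw [← lintegral_add_compl _ hD] at e1
    have e2 : ∫⁻ z in D, G.step z D ∂π = π D := by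
      rw [← setLIntegral_one]
      refine setLIntegral_congr_fun hD fun z hz => ?_
      exact (mem_ae_iff_prob_eq_one hD).1 (hDD z hz)
    rw [e2] at e1
    have e3 : ∫⁻ z in Dᶜ, G.step z D ∂π = 0 := by
      have := measure_ne_top π D
      exact (ENNReal.add_right_inj this).1 (by rw [e1, add_zero])
    rw [lintegral_eq_zero_iff hm] at e3
    exact (ae_restrict_iff' hD.compl).1 e3
  filter_upwards [h1, h2] with z hz1 hz2 hz
  by_contra hn
  refine hZ z hz (measure_mono_null (t := {w | ¬ (w ∈ Y → w ∈ D)} ∪ D) ?_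
    (measure_union_null hz1 (hz2 hn)))
  intro w hw
  by_cases h : w ∈ D
  · exact Or.inr h
  · left
    simp only [mem_ofPred_eq]
    rcases hw with hw | hw <;> tauto

end Chain

/-! ### The example and the laws of its delays -/

/-- The scheduled events of the example: the states `0, 1, 2` are the `1`-states, the states
`3, 4, 5` are their mirror images, and the state `6` restarts the process. -/
def exampleSched : Fin 7 → Finset (Fin 3) :=
  ![{0, 1, 2}, {0, 1}, {0, 2}, {0, 1, 2}, {0, 1}, {0, 2}, {2}]

/-- The successor states of the example, which are deterministic. -/
def exampleTarget (s : Fin 7) (W : Finset (Fin 3)) : Fin 7 :=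
  if W = {0} then ![6, 0, 6, 6, 3, 6, 6] s
  else if W = {1} then ![2, 1, 6, 5, 4, 6, 6] s
  else if W = {2} then ![1, 6, 4, 4, 6, 1, 2] s
  else 6

theorem example_support :
    {x : ℝ | ((![2, 2, 1] : Fin 3 → ℕ) 2 : ℝ) ≤ x ∧
      ∀ m : ℕ, (![2, 2, 2] : Fin 3 → ℕ∞) 2 = m → x ≤ m} = Icc 1 2 := by
  ext x
  simp only [mem_ofPred_eq, mem_Icc]
  constructor
  · rintro ⟨h1, h2⟩
    exact ⟨by simpa using h1, by simpa using h2 2 (by simp)⟩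
  · rintro ⟨h1, h2⟩
    refine ⟨by simpa using h1, fun m hm => ?_⟩
    have : (2 : ℕ∞) = m := by simpa using hm
    have : m = 2 := by exact_mod_cast this.symm
    simpa [this] using h2

theorem example_variable {e : Fin 3}
    (h : ((![2, 2, 1] : Fin 3 → ℕ) e : ℕ∞) < (![2, 2, 2] : Fin 3 → ℕ∞) e) : e = 2 := by
  fin_cases e <;> simp_all

/-- Two events of delay `2` are shifted against each other, and a third event, which is uniform on
`[1, 2]` and scheduled anew at each occurrence of the first one, may decrease the shift. -/
def shiftExample : GSMP (Fin 7) (Fin 3) where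
  lower := ![2, 2, 1]
  upper := ![2, 2, 2]
  upper_ne_zero e := by fin_cases e <;> simp
  lower_le_upper e := by fin_cases e <;> simp
  density _ := (Icc (1 : ℝ) 2).indicator 1
  density_continuousOn e h := by
    obtain rfl := example_variable h
    rw [example_support]
    exact continuousOn_const.congr fun x hx => indicator_of_mem hx _
  density_pos e h x hx := by
    obtain rfl := example_variable h
    rw [example_support] at hx
    simp [indicator_of_mem hx]
  density_zero e h x hx := by
    obtain rfl := example_variable h
    rw [example_support] at hx
    exact indicator_of_notMem hx _
  density_integral e h := by
    rw [integral_indicator_one measurableSet_Icc]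
    norm_num [Measure.real]
  density_mean e h := by
    have : (fun x : ℝ => x * (Icc (1 : ℝ) 2).indicator 1 x) =
        (Icc (1 : ℝ) 2).indicator fun x => x := by
      funext x
      by_cases hx : x ∈ Icc (1 : ℝ) 2 <;> simp [hx]
    rw [this]
    exact (continuous_id.integrableOn_Icc).integrable_indicator measurableSet_Icc
  sched := exampleSched
  sched_nonempty s := by fin_cases s <;> simp [exampleSched]
  succ s W := PMF.pure (exampleTarget s W)
  init := PMF.pure 2

theorem delayLaw_shiftExample_zero : shiftExample.delayLaw 0 = Measure.dirac 2 := by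
  simp [delayLaw, shiftExample]

theorem delayLaw_shiftExample_one : shiftExample.delayLaw 1 = Measure.dirac 2 := by
  simp [delayLaw, shiftExample]

theorem delayLaw_shiftExample_two :
    shiftExample.delayLaw 2 = (volume : Measure ℝ).restrict (Icc 1 2) := by
  have h : ((shiftExample.lower 2 : ℕ) : ℕ∞) < shiftExample.upper 2 := by
    simp [shiftExample]
  rw [delayLaw, if_pos h, ← withDensity_indicator_one measurableSet_Icc]
  congr 1
  funext x
  by_cases hx : x ∈ Icc (1 : ℝ) 2 <;> simp [shiftExample, hx]

/-- In the overdue case d ≤ a the convention that the event occurs at once agrees with truncated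
subtraction, so one formula serves all ages. -/
theorem residualLaw_eq_dirac {S E : Type} [Fintype S] [Fintype E] {G : GSMP S E} {e : E} {d : ℝ≥0}
    (h : G.delayLaw e = Measure.dirac (d : ℝ)) (a : ℝ≥0) :
    G.residualLaw e a = Measure.dirac (d - a) := by
  unfold residualLaw
  rw [h]
  by_cases hd : (a : ℝ) < d
  · rw [if_neg (by simp [hd]), ProbabilityTheory.cond, Measure.dirac_apply' _ measurableSet_Ioi,
      indicator_of_mem (by exact hd)]
    rw [restrict_dirac' measurableSet_Ioi, if_pos (by exact hd)]
    simp only [Pi.one_apply, inv_one, one_smul]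
    rw [Measure.map_dirac' (by fun_prop)]
    rfl
  · rw [if_pos (by simp [hd]), tsub_eq_zero_of_le (by exact_mod_cast not_lt.1 hd)]

theorem restrict_Icc_Ioi_ne_zero {a : ℝ≥0} (ha : a < 2) :
    (volume : Measure ℝ).restrict (Icc 1 2) (Ioi (a : ℝ)) ≠ 0 := by
  have ha' : (a : ℝ) < 2 := by exact_mod_cast ha
  rw [Measure.restrict_apply measurableSet_Ioi]
  refine fun h => absurd (measure_mono_null (t := Ioi (a : ℝ) ∩ Icc 1 2)
    (s := Ioo (max (a : ℝ) 1) 2) ?_ h) ?_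
  · rintro x ⟨hx1, hx2⟩
    exact ⟨(le_max_left _ _).trans_lt hx1, ((le_max_right _ _).trans_lt hx1).le, hx2.le⟩
  · simp [Real.volume_Ioo, ha']

theorem residualLaw_two {a : ℝ≥0} (ha : a < 2) :
    shiftExample.residualLaw 2 a = (((volume : Measure ℝ).restrict (Icc 1 2))[|Ioi (a : ℝ)]).map
      fun x : ℝ => (x - a).toNNReal := by
  rw [residualLaw, delayLaw_shiftExample_two, if_neg (restrict_Icc_Ioi_ne_zero ha)]

theorem residualLaw_two_apply {a : ℝ≥0} (ha : a < 2) {B : Set ℝ≥0} (hB : MeasurableSet B) :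
    shiftExample.residualLaw 2 a B =
      ((volume : Measure ℝ).restrict (Icc 1 2) (Ioi (a : ℝ)))⁻¹ *
        (volume : Measure ℝ).restrict (Icc 1 2)
          (Ioi (a : ℝ) ∩ (fun x : ℝ => (x - a).toNNReal) ⁻¹' B) := by
  rw [residualLaw_two ha, Measure.map_apply (by fun_prop) hB, cond_apply measurableSet_Ioi]

/-- The conditional law has no atoms, so it avoids the endpoints and any prescribed c. Taking for c
the due time of event 1 excludes ties. -/
theorem ae_residualLaw_two {a : ℝ≥0} (ha : a < 2) (c : ℝ≥0) :
    ∀ᵐ r ∂shiftExample.residualLaw 2 a, 0 < r ∧ 1 < a + r ∧ a + r < 2 ∧ r ≠ c := by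
  rw [residualLaw_two ha]
  have hm : MeasurableSet {r : ℝ≥0 | 0 < r ∧ 1 < a + r ∧ a + r < 2 ∧ r ≠ c} := by
    refine MeasurableSet.inter measurableSet_Ioi (MeasurableSet.inter ?_ (MeasurableSet.inter ?_ ?_))
    · exact measurableSet_lt measurable_const (by fun_prop)
    · exact measurableSet_lt (by fun_prop) measurable_const
    · exact (measurableSet_singleton c).compl
  rw [ae_map_iff (by fun_prop) hm]
  have h1 : ∀ᵐ x ∂(volume : Measure ℝ).restrict (Icc 1 2),
      x ∈ Icc (1 : ℝ) 2 ∧ x ≠ 1 ∧ x ≠ 2 ∧ x ≠ a + c := by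
    filter_upwards [ae_restrict_mem measurableSet_Icc, Measure.ae_ne _ 1, Measure.ae_ne _ 2,
      Measure.ae_ne _ ((a : ℝ) + c)] with x h1 h2 h3 h4 using ⟨h1, h2, h3, h4⟩
  filter_upwards [cond_absolutelyContinuous h1, ae_cond_mem measurableSet_Ioi]
    with x ⟨⟨hx1, hx2⟩, hx3, hx4, hx5⟩ hx
  have hx : (a : ℝ) < x := hx
  have e : (((x - a).toNNReal : ℝ≥0) : ℝ) = x - a := Real.coe_toNNReal _ (by linarith)
  refine ⟨?_, ?_, ?_, ?_⟩
  · rw [← NNReal.coe_lt_coe, e]; simpa using hx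
  · rw [← NNReal.coe_lt_coe]; push_cast; rw [e]
    have := lt_of_le_of_ne hx1 hx3.symm
    linarith
  · rw [← NNReal.coe_lt_coe]; push_cast; rw [e]
    have := lt_of_le_of_ne hx2 hx4
    linarith
  · rintro rfl
    rw [e] at hx5
    exact hx5 (by ring)

theorem residualLaw_two_Ioi_ne_zero {a b : ℝ≥0} (ha : a < 2) (hb : b < 2) :
    shiftExample.residualLaw 2 a {r | b < a + r} ≠ 0 := by
  rw [residualLaw_two_apply ha (measurableSet_lt measurable_const (by fun_prop))]
  refine mul_ne_zero (ENNReal.inv_ne_zero.2 (measure_ne_top _ _)) fun h => ?_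
  refine restrict_Icc_Ioi_ne_zero (max_lt ha hb) (measure_mono_null ?_ h)
  intro x hx
  have hx : max (a : ℝ) b < x := by simpa using hx
  rw [max_lt_iff] at hx
  refine ⟨hx.1, ?_⟩
  have e : (((x - a).toNNReal : ℝ≥0) : ℝ) = x - a := Real.coe_toNNReal _ (by linarith [hx.1])
  change b < a + (x - a).toNNReal
  rw [← NNReal.coe_lt_coe]; push_cast; rw [e]; linarith [hx.2]

/-- The delay of the uniform event. -/
abbrev uniformLaw : Measure ℝ≥0 := shiftExample.residualLaw 2 0

theorem uniformLaw_apply {B : Set ℝ≥0} (hB : MeasurableSet B) :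
    uniformLaw B = (volume : Measure ℝ).restrict (Icc 1 2) (Real.toNNReal ⁻¹' B) := by
  have h0 : ∀ T : Set ℝ, (volume : Measure ℝ).restrict (Icc 1 2) (Ioi 0 ∩ T) =
      (volume : Measure ℝ).restrict (Icc 1 2) T := by
    intro T
    rw [inter_comm]
    refine measure_inter_conull ?_
    rw [← mem_ae_iff]
    filter_upwards [ae_restrict_mem measurableSet_Icc] with x hx
    exact lt_of_lt_of_le one_pos hx.1
  rw [residualLaw_two_apply (by norm_num) hB]
  simp only [NNReal.coe_zero, sub_zero]
  rw [h0, ← inter_univ (Ioi (0 : ℝ)), h0, Measure.restrict_apply_univ, Real.volume_Icc]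
  norm_num

/-- The uniform delay is either smaller than `a`, or it exceeds `a` by a residual time. -/
theorem uniformLaw_split {a : ℝ≥0} (ha : a < 2) {B : Set ℝ≥0} (hB : MeasurableSet B) :
    uniformLaw (Iio a ∩ B) + uniformLaw (Ioi a) * shiftExample.residualLaw 2 a {r | a + r ∈ B} =
      uniformLaw B := by
  have hB' : MeasurableSet {r : ℝ≥0 | a + r ∈ B} :=
    hB.preimage (by fun_prop : Measurable fun r : ℝ≥0 => a + r)
  have h1 : Real.toNNReal ⁻¹' (Ioi a) = Ioi (a : ℝ) := by
    ext x
    simp [Real.lt_toNNReal_iff_coe_lt]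
  have h2 : Ioi (a : ℝ) ∩ (fun x : ℝ => (x - a).toNNReal) ⁻¹' {r : ℝ≥0 | a + r ∈ B} =
      Ioi (a : ℝ) ∩ Real.toNNReal ⁻¹' B := by
    ext x
    simp only [mem_inter_iff, mem_Ioi, mem_preimage, mem_ofPred_eq, and_congr_right_iff]
    intro hx
    have : a + (x - a).toNNReal = x.toNNReal := by
      rw [← NNReal.coe_inj]; push_cast
      rw [Real.coe_toNNReal _ (by linarith), Real.coe_toNNReal _ (a.2.trans hx.le)]
      ring
    rw [this]
  rw [residualLaw_two_apply ha hB', uniformLaw_apply measurableSet_Ioi, h1, h2, ← mul_assoc,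
    ENNReal.mul_inv_cancel (restrict_Icc_Ioi_ne_zero ha) (measure_ne_top _ _), one_mul]
  have h3 : Ioi (a : ℝ) ∩ Real.toNNReal ⁻¹' B = Real.toNNReal ⁻¹' (Ioi a ∩ B) := by
    rw [preimage_inter, h1]
  rw [h3, ← uniformLaw_apply (measurableSet_Ioi.inter hB), ← measure_union _
    (measurableSet_Ioi.inter hB)]
  -- The two pieces omit only the point a, which is not charged.
  · refine measure_congr ?_
    filter_upwards [ae_residualLaw_two (a := 0) (by norm_num) a] with r hr
    apply propext
    change r ∈ Iio a ∩ B ∪ Ioi a ∩ B ↔ r ∈ B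
    have := hr.2.2.2.lt_or_gt
    simp only [mem_union, mem_inter_iff, mem_Iio, mem_Ioi]
    tauto
  · exact (Set.disjoint_left.2 fun x hx hx' => lt_asymm (show x < a from hx.1) hx'.1)

theorem uniformLaw_Ioc {a b : ℝ≥0} (ha : 1 ≤ a) (hb : b ≤ 2) :
    uniformLaw (Ioc a b) = (b - a : ℝ≥0) := by
  have ha' : (1 : ℝ) ≤ a := by exact_mod_cast ha
  have hb' : (b : ℝ) ≤ 2 := by exact_mod_cast hb
  have h : Real.toNNReal ⁻¹' Ioc a b ∩ Icc 1 2 = Ioc (a : ℝ) b := by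
    ext x
    simp only [mem_inter_iff, mem_preimage, mem_Ioc, mem_Icc, Real.lt_toNNReal_iff_coe_lt,
      Real.toNNReal_le_iff_le_coe]
    constructor
    · rintro ⟨h, -⟩
      exact h
    · rintro ⟨h1, h2⟩
      exact ⟨⟨h1, h2⟩, by linarith, by linarith⟩
  rw [uniformLaw_apply measurableSet_Ioc, Measure.restrict_apply
    (measurableSet_Ioc.preimage (by fun_prop)), h, Real.volume_Ioc, ENNReal.ofReal,
    NNReal.sub_def]

theorem uniformLaw_Iic {b : ℝ≥0} (hb : b ≤ 2) : uniformLaw (Iic b) = (b - 1 : ℝ≥0) := by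
  have hb' : (b : ℝ) ≤ 2 := by exact_mod_cast hb
  have h : Real.toNNReal ⁻¹' Iic b ∩ Icc 1 2 = Icc (1 : ℝ) b := by
    ext x
    simp only [mem_inter_iff, mem_preimage, mem_Iic, mem_Icc, Real.toNNReal_le_iff_le_coe]
    constructor
    · rintro ⟨h1, h2, -⟩
      exact ⟨h2, h1⟩
    · rintro ⟨h1, h2⟩
      exact ⟨h2, h1, by linarith⟩
  rw [uniformLaw_apply measurableSet_Iic, Measure.restrict_apply
    (measurableSet_Iic.preimage (by fun_prop)), h, Real.volume_Icc, ENNReal.ofReal,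
    NNReal.sub_def, NNReal.coe_one]

/-! ### One step of the example as a function of a single random number -/

theorem firstTime_eq {S E : Type} [Fintype S] [Fintype E] (G : GSMP S E) {s : S} {x : E → ℝ≥0}
    {e : E} (he : e ∈ G.sched s) (h : ∀ e' ∈ G.sched s, e' ≠ e → x e < x e') :
    G.firstTime s x = x e := by
  refine le_antisymm (Finset.inf'_le _ he) (Finset.le_inf' _ _ fun e' he' => ?_)
  by_cases h' : e' = e
  · rw [h']
  · exact (h e' he' h').le

theorem winners_eq {S E : Type} [Fintype S] [Fintype E] (G : GSMP S E) {s : S} {x : E → ℝ≥0}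
    {e : E} (he : e ∈ G.sched s) (h : ∀ e' ∈ G.sched s, e' ≠ e → x e < x e') :
    G.winners s x = {e} := by
  ext e'
  simp only [winners, Finset.mem_filter, Finset.mem_singleton, G.firstTime_eq he h]
  constructor
  · rintro ⟨h1, h2⟩
    by_contra h'
    exact (h e' h1 h').ne' h2
  · rintro rfl
    exact ⟨he, rfl⟩

/-- The remaining times in the configuration `z`, when `r` is that of the uniform event. -/
def remaining (z : shiftExample.Config) (r : ℝ≥0) : Fin 3 → ℝ≥0 :=
  ![2 - z.age 0, 2 - z.age 1, r]

/-- The configuration that follows `z` when `r` is the remaining time of the uniform event. -/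
def outcome (z : shiftExample.Config) (r : ℝ≥0) : shiftExample.Config :=
  shiftExample.next z (shiftExample.firstTime z.state (remaining z r))
    (shiftExample.winners z.state (remaining z r))
    (exampleTarget z.state (shiftExample.winners z.state (remaining z r)))

/-- Two of the three coordinates are Dirac masses, so the residual time of event 2 is the only
randomness of a step. It is drawn even where event 2 is not scheduled, without effect on the
outcome. -/
theorem race_shiftExample (z : shiftExample.Config) :
    shiftExample.race z = (shiftExample.residualLaw 2 (z.age 2)).map (remaining z) := by
  have hm : Measurable (remaining z) := by
    refine measurable_pi_lambda _ fun e => ?_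
    fin_cases e
    · exact measurable_const
    · exact measurable_const
    · exact measurable_id
  change Measure.pi (fun e => shiftExample.residualLaw e (z.age e)) = _
  refine Measure.pi_eq fun B hB => ?_
  rw [Measure.map_apply hm (MeasurableSet.univ_pi hB), Fin.prod_univ_three,
    residualLaw_eq_dirac (e := 0) (d := 2) (by simpa using delayLaw_shiftExample_zero),
    residualLaw_eq_dirac (e := 1) (d := 2) (by simpa using delayLaw_shiftExample_one),
    Measure.dirac_apply' _ (hB 0), Measure.dirac_apply' _ (hB 1)]
  have : remaining z ⁻¹' univ.pi B =
      {r | 2 - z.age 0 ∈ B 0 ∧ 2 - z.age 1 ∈ B 1 ∧ r ∈ B 2} := by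
    ext r
    simp [remaining, Set.mem_pi, Fin.forall_fin_succ]
  rw [this]
  by_cases h0 : 2 - z.age 0 ∈ B 0 <;> by_cases h1 : 2 - z.age 1 ∈ B 1 <;> simp [h0, h1]

theorem lintegral_step_shiftExample (z : shiftExample.Config) {h : shiftExample.Config → ℝ≥0∞}
    (hh : Measurable h) :
    ∫⁻ w, h w ∂shiftExample.step z =
      ∫⁻ r, h (outcome z r) ∂shiftExample.residualLaw 2 (z.age 2) := by
  have hm : Measurable (remaining z) := by
    refine measurable_pi_lambda _ fun e => ?_
    fin_cases e
    · exact measurable_const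
    · exact measurable_const
    · exact measurable_id
  have hj : Measurable fun p => ∫⁻ w, h w ∂shiftExample.jump p := hh.lintegral_kernel
  rw [step, Kernel.lintegral_comp _ _ _ hh, Kernel.lintegral_prod _ _ _ hj, Kernel.id_apply,
    lintegral_dirac' _ (Measurable.lintegral_prod_right' hj), race_shiftExample,
    lintegral_map (by exact hj.comp measurable_prodMk_left) hm]
  refine lintegral_congr fun r => ?_
  change ∫⁻ w, h w ∂(((shiftExample.succ z.state
    (shiftExample.winners z.state (remaining z r))).toMeasure).map _) = _
  rw [lintegral_map hh (measurable_of_countable _)]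
  change ∫⁻ s, _ ∂((PMF.pure (exampleTarget z.state
    (shiftExample.winners z.state (remaining z r)))).toMeasure) = _
  rw [PMF.toMeasure_pure, lintegral_dirac]
  rfl

theorem step_shiftExample_apply (z : shiftExample.Config) {B : Set shiftExample.Config}
    (hB : MeasurableSet B) {A : Set ℝ≥0} (hA : MeasurableSet A)
    (h : ∀ᵐ r ∂shiftExample.residualLaw 2 (z.age 2), outcome z r ∈ B ↔ r ∈ A) :
    shiftExample.step z B = shiftExample.residualLaw 2 (z.age 2) A := by
  rw [← lintegral_indicator_one hB, lintegral_step_shiftExample z (measurable_one.indicator hB),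
    ← lintegral_indicator_one hA]
  refine lintegral_congr_ae ?_
  filter_upwards [h] with r hr
  by_cases h' : r ∈ A <;> simp [hr, h']

theorem residualLaw_le_step (z : shiftExample.Config) {B : Set shiftExample.Config}
    (hB : MeasurableSet B) {A : Set ℝ≥0} (hA : MeasurableSet A)
    (h : ∀ᵐ r ∂shiftExample.residualLaw 2 (z.age 2), r ∈ A → outcome z r ∈ B) :
    shiftExample.residualLaw 2 (z.age 2) A ≤ shiftExample.step z B := by
  rw [← lintegral_indicator_one hB, lintegral_step_shiftExample z (measurable_one.indicator hB),
    ← lintegral_indicator_one hA]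
  refine lintegral_mono_ae ?_
  filter_upwards [h] with r hr
  by_cases h' : r ∈ A <;> simp [hr, h']

theorem ae_step_shiftExample {z : shiftExample.Config} {B : Set shiftExample.Config}
    (hB : MeasurableSet B)
    (h : ∀ᵐ r ∂shiftExample.residualLaw 2 (z.age 2), outcome z r ∈ B) :
    ∀ᵐ w ∂shiftExample.step z, w ∈ B := by
  refine (mem_ae_iff_prob_eq_one hB).2 (le_antisymm prob_le_one ?_)
  rw [← measure_univ (μ := shiftExample.residualLaw 2 (z.age 2))]
  exact residualLaw_le_step z hB MeasurableSet.univ (h.mono fun _ h _ => h)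

theorem state_outcome (z : shiftExample.Config) (r : ℝ≥0) : (outcome z r).state =
    exampleTarget z.state (shiftExample.winners z.state (remaining z r)) := rfl

/-- The state of the configuration reached from `z` when the event `e` occurs first, alone. -/
theorem outcome_of_lt {z : shiftExample.Config} {r : ℝ≥0} {e : Fin 3}
    (he : e ∈ exampleSched z.state)
    (h : ∀ e' ∈ exampleSched z.state, e' ≠ e → remaining z r e < remaining z r e') :
    (outcome z r).state = exampleTarget z.state {e} ∧ (outcome z r).last = remaining z r e ∧
      ∀ e', (outcome z r).age e' =
        if e' ∈ exampleSched (exampleTarget z.state {e}) ∧ e' ∈ exampleSched z.state ∧ e' ≠ e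
        then z.age e' + remaining z r e else 0 := by
  have h1 := shiftExample.firstTime_eq (s := z.state) he h
  have h2 := shiftExample.winners_eq (s := z.state) he h
  have : outcome z r = shiftExample.next z (remaining z r e) {e} (exampleTarget z.state {e}) := by
    rw [outcome, h1, h2]
  rw [this]
  refine ⟨rfl, rfl, fun e' => ?_⟩
  simp only [next, Config.age, Finset.mem_singleton, shiftExample, Config.state]
  congr 1

/-- All three events are scheduled. -/
def ready (b : Bool) : Fin 7 := cond b 0 3

/-- The uniform event is not scheduled. -/
def busy (b : Bool) : Fin 7 := cond b 1 4

/-- The second event waits for the uniform event. -/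
def waiting (b : Bool) : Fin 7 := cond b 2 5

theorem outcome_ready_two {z : shiftExample.Config} {b : Bool} (hz : z.state = ready b) {r : ℝ≥0}
    (h0 : r < 2 - z.age 0) (h1 : r < 2 - z.age 1) :
    (outcome z r).state = busy b ∧ (outcome z r).last = r ∧ (outcome z r).age 0 = z.age 0 + r ∧
      (outcome z r).age 1 = z.age 1 + r ∧ (outcome z r).age 2 = 0 := by
  obtain ⟨k1, k2, k3⟩ := outcome_of_lt (z := z) (r := r) (e := 2)
    (by cases b <;> simp [hz, ready, exampleSched])
    (by intro e he hne; fin_cases e <;> simp_all [remaining])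
  rw [k1, k2, k3, k3, k3, hz]
  cases b <;> simp [ready, busy, exampleTarget, exampleSched, remaining]

theorem outcome_ready_one {z : shiftExample.Config} {b : Bool} (hz : z.state = ready b) {r : ℝ≥0}
    (h0 : 2 - z.age 1 < 2 - z.age 0) (h1 : 2 - z.age 1 < r) :
    (outcome z r).state = waiting b ∧ (outcome z r).last = 2 - z.age 1 ∧
      (outcome z r).age 0 = z.age 0 + (2 - z.age 1) ∧
      (outcome z r).age 1 = 0 ∧ (outcome z r).age 2 = z.age 2 + (2 - z.age 1) := by
  obtain ⟨k1, k2, k3⟩ := outcome_of_lt (z := z) (r := r) (e := 1)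
    (by cases b <;> simp [hz, ready, exampleSched])
    (by intro e he hne; fin_cases e <;> simp_all [remaining])
  rw [k1, k2, k3, k3, k3, hz]
  cases b <;> simp [ready, waiting, exampleTarget, exampleSched, remaining]

theorem outcome_busy_one {z : shiftExample.Config} {b : Bool} (hz : z.state = busy b) (r : ℝ≥0)
    (h0 : 2 - z.age 1 < 2 - z.age 0) :
    (outcome z r).state = busy b ∧ (outcome z r).last = 2 - z.age 1 ∧
      (outcome z r).age 0 = z.age 0 + (2 - z.age 1) ∧
      (outcome z r).age 1 = 0 ∧ (outcome z r).age 2 = 0 := by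
  obtain ⟨k1, k2, k3⟩ := outcome_of_lt (z := z) (r := r) (e := 1)
    (by cases b <;> simp [hz, busy, exampleSched])
    (by intro e he hne; cases b <;> fin_cases e <;> simp_all [remaining, exampleSched, busy])
  rw [k1, k2, k3, k3, k3, hz]
  cases b <;> simp [busy, exampleTarget, exampleSched, remaining]

theorem outcome_busy_zero {z : shiftExample.Config} {b : Bool} (hz : z.state = busy b) (r : ℝ≥0)
    (h0 : 2 - z.age 0 < 2 - z.age 1) :
    (outcome z r).state = ready b ∧ (outcome z r).last = 2 - z.age 0 ∧
      (outcome z r).age 0 = 0 ∧ (outcome z r).age 1 = z.age 1 + (2 - z.age 0) ∧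
      (outcome z r).age 2 = 0 := by
  obtain ⟨k1, k2, k3⟩ := outcome_of_lt (z := z) (r := r) (e := 0)
    (by cases b <;> simp [hz, busy, exampleSched])
    (by intro e he hne; cases b <;> fin_cases e <;> simp_all [remaining, exampleSched, busy])
  rw [k1, k2, k3, k3, k3, hz]
  cases b <;> simp [busy, ready, exampleTarget, exampleSched, remaining]

theorem outcome_waiting {z : shiftExample.Config} {b : Bool} (hz : z.state = waiting b) {r : ℝ≥0}
    (h0 : r < 2 - z.age 0) :
    (outcome z r).state = busy !b ∧ (outcome z r).last = r ∧ (outcome z r).age 0 = z.age 0 + r ∧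
      (outcome z r).age 1 = 0 ∧ (outcome z r).age 2 = 0 := by
  obtain ⟨k1, k2, k3⟩ := outcome_of_lt (z := z) (r := r) (e := 2)
    (by cases b <;> simp [hz, waiting, exampleSched])
    (by intro e he hne; cases b <;> fin_cases e <;> simp_all [remaining, exampleSched, waiting])
  rw [k1, k2, k3, k3, k3, hz]
  cases b <;> simp [busy, waiting, exampleTarget, exampleSched, remaining]

theorem outcome_restart {z : shiftExample.Config} (hz : z.state = 6) (r : ℝ≥0) :
    (outcome z r).state = waiting true ∧ (outcome z r).age 0 = 0 ∧ (outcome z r).age 2 = 0 := by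
  obtain ⟨k1, k2, k3⟩ := outcome_of_lt (z := z) (r := r) (e := 2)
    (by simp [hz, exampleSched])
    (by intro e he hne; fin_cases e <;> simp_all [exampleSched])
  rw [k1, k3, k3, hz]
  simp [waiting, exampleTarget, exampleSched]

/-- In predicate form, this and the next two facts let `fun_prop` prove measurability of sets given
by conditions on states and ages. -/
theorem measurable_eq_nnreal {α : Type*} [MeasurableSpace α] {f g : α → ℝ≥0}
    (hf : Measurable f) (hg : Measurable g) : Measurable fun a => f a = g a :=
  measurableSet_setOfPred.1 (measurableSet_eq_fun hf hg)

theorem measurable_lt_nnreal {α : Type*} [MeasurableSpace α] {f g : α → ℝ≥0}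
    (hf : Measurable f) (hg : Measurable g) : Measurable fun a => f a < g a :=
  measurableSet_setOfPred.1 (measurableSet_lt hf hg)

theorem measurable_state_eq {α : Type*} [MeasurableSpace α] {f : α → shiftExample.Config}
    (hf : Measurable f) (s : Fin 7) : Measurable fun a => (f a).state = s :=
  measurableSet_setOfPred.1 ((shiftExample.measurable_state.comp hf) (measurableSet_singleton s))

attribute [local fun_prop] measurable_eq_nnreal measurable_lt_nnreal measurable_state_eq
  Measurable.and Measurable.or Measurable.imp Measurable.not Measurable.exists Measurable.forall
  measurable_age measurable_last

theorem shiftExample_state_cases (s : Fin 7) :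
    (∃ b, s = ready b) ∨ (∃ b, s = busy b) ∨ (∃ b, s = waiting b) ∨ s = 6 := by
  revert s; decide

/-! ### Configurations of small shift and the transitions between them -/

/-- The configurations that are visited when the distance between the two fixed-delay events is
less than `q`. -/
def close (q : ℝ≥0) : Set shiftExample.Config :=
  {w | ((∃ b, w.state = ready b) ∧ w.age 0 = 0 ∧ w.age 2 = 0 ∧ 0 < w.age 1 ∧ w.age 1 < q) ∨
    ((∃ b, w.state = busy b) ∧
      ((w.age 1 = 0 ∧ w.age 0 < 2 ∧ 2 < w.age 0 + q) ∨
        (w.age 0 < w.age 1 ∧ w.age 1 < w.age 0 + q ∧ w.age 1 < 2))) ∨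
    ((∃ b, w.state = waiting b) ∧ w.age 0 = w.age 2 ∧ w.age 0 < 2 ∧ 2 < w.age 0 + q)}

theorem measurableSet_close (q : ℝ≥0) : MeasurableSet (close q) := by
  apply measurableSet_setOfPred.2
  fun_prop

theorem ready_injective : Function.Injective ready := by decide
theorem busy_injective : Function.Injective busy := by decide
theorem waiting_injective : Function.Injective waiting := by decide
theorem ready_ne_busy (b c : Bool) : ready b ≠ busy c := by revert b c; decide
theorem ready_ne_waiting (b c : Bool) : ready b ≠ waiting c := by revert b c; decide
theorem busy_ne_waiting (b c : Bool) : busy b ≠ waiting c := by revert b c; decide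

theorem close_ready {q : ℝ≥0} {z : shiftExample.Config} {b : Bool} (hb : z.state = ready b) :
    z ∈ close q ↔ z.age 0 = 0 ∧ z.age 2 = 0 ∧ 0 < z.age 1 ∧ z.age 1 < q := by
  simp [close, hb, ready_ne_busy, ready_ne_waiting, ready_injective.eq_iff]

theorem close_busy {q : ℝ≥0} {z : shiftExample.Config} {b : Bool} (hb : z.state = busy b) :
    z ∈ close q ↔ ((z.age 1 = 0 ∧ z.age 0 < 2 ∧ 2 < z.age 0 + q) ∨
        (z.age 0 < z.age 1 ∧ z.age 1 < z.age 0 + q ∧ z.age 1 < 2)) := by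
  simp [close, hb, (ready_ne_busy _ _).symm, busy_ne_waiting, busy_injective.eq_iff]

theorem close_waiting {q : ℝ≥0} {z : shiftExample.Config} {b : Bool} (hb : z.state = waiting b) :
    z ∈ close q ↔ z.age 0 = z.age 2 ∧ z.age 0 < 2 ∧ 2 < z.age 0 + q := by
  simp [close, hb, (ready_ne_waiting _ _).symm, (busy_ne_waiting _ _).symm,
    waiting_injective.eq_iff]

/-- The transitions between the configurations of `close 1`. -/
def Follows (z w : shiftExample.Config) : Prop :=
  ∀ b, (z.state = ready b →
      (w.state = busy b ∧ w.age 0 = w.last ∧ w.age 1 = z.age 1 + w.last ∧ 1 < w.last) ∨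
      (w.state = waiting b ∧ w.age 0 = w.last ∧ w.last + z.age 1 = 2)) ∧
    (z.state = busy b →
      (z.age 1 = 0 ∧ w.state = ready b ∧ w.last + z.age 0 = 2 ∧ w.age 1 + z.age 0 = 2) ∨
      (0 < z.age 1 ∧ w.state = busy b ∧ w.last + z.age 1 = 2 ∧ w.age 1 = 0 ∧
        w.age 0 = z.age 0 + w.last)) ∧
    (z.state = waiting b →
      w.state = busy !b ∧ w.age 1 = 0 ∧ w.age 0 = z.age 0 + w.last ∧ 0 < w.last)

theorem measurableSet_follows :
    MeasurableSet {p : shiftExample.Config × shiftExample.Config | Follows p.1 p.2} := by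
  apply measurableSet_setOfPred.2
  unfold Follows
  fun_prop

theorem follows_ready {z w : shiftExample.Config} {b : Bool} (hb : z.state = ready b) :
    Follows z w ↔
      (w.state = busy b ∧ w.age 0 = w.last ∧ w.age 1 = z.age 1 + w.last ∧ 1 < w.last) ∨
      (w.state = waiting b ∧ w.age 0 = w.last ∧ w.last + z.age 1 = 2) := by
  simp [Follows, hb, ready_injective.eq_iff, ready_ne_busy, ready_ne_waiting]

theorem follows_busy {z w : shiftExample.Config} {b : Bool} (hb : z.state = busy b) :
    Follows z w ↔
      (z.age 1 = 0 ∧ w.state = ready b ∧ w.last + z.age 0 = 2 ∧ w.age 1 + z.age 0 = 2) ∨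
      (0 < z.age 1 ∧ w.state = busy b ∧ w.last + z.age 1 = 2 ∧ w.age 1 = 0 ∧
        w.age 0 = z.age 0 + w.last) := by
  simp [Follows, hb, busy_injective.eq_iff, (ready_ne_busy _ _).symm, busy_ne_waiting]

theorem follows_waiting {z w : shiftExample.Config} {b : Bool} (hb : z.state = waiting b) :
    Follows z w ↔ w.state = busy !b ∧ w.age 1 = 0 ∧ w.age 0 = z.age 0 + w.last ∧ 0 < w.last := by
  simp [Follows, hb, waiting_injective.eq_iff, (ready_ne_waiting _ _).symm,
    (busy_ne_waiting _ _).symm]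

/-- The shift is the age of event 1 in `ready`, the difference of the two ages while events 0 and 1
both run with event 1 the older, and 2 minus the age of event 0 in `waiting` and just after event 1
has been scheduled. No transition increases it, and only the one out of `waiting` changes it. -/
theorem ae_outcome_close {q : ℝ≥0} (hq : q ≤ 1) {z : shiftExample.Config} (hz : z ∈ close q) :
    ∀ᵐ r ∂shiftExample.residualLaw 2 (z.age 2), outcome z r ∈ close q ∧ Follows z (outcome z r) := by
  have hsub : ∀ a : ℝ≥0, a ≤ 2 → 2 - a + a = 2 := fun a ha => tsub_add_cancel_of_le ha
  have p0 : 0 ≤ z.age 0 := (z.age 0).2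
  obtain ⟨b, hb⟩ | ⟨b, hb⟩ | ⟨b, hb⟩ | hb := shiftExample_state_cases z.state
  · obtain ⟨h0, h2, h1, h1q⟩ := (close_ready hb).1 hz
    rw [h2]
    -- The excluded value is the due time of event 1; a tie there would lead to the state 6.
    filter_upwards [ae_residualLaw_two (a := 0) (by norm_num) (2 - z.age 1)] with r ⟨_, hr1, hr2, hr⟩
    rw [zero_add] at hr1 hr2
    have h12 := hsub (z.age 1) (by grind)
    rw [follows_ready hb]
    rcases hr.lt_or_gt with hlt | hgt
    · obtain ⟨k1, k2, k3, k4, k5⟩ := outcome_ready_two hb (by rw [h0]; simpa using hr2) hlt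
      rw [close_busy k1]
      refine ⟨Or.inr ⟨?_, ?_, ?_⟩, Or.inl ⟨k1, ?_, ?_, ?_⟩⟩ <;> grind
    · obtain ⟨k1, k2, k3, k4, k5⟩ := outcome_ready_one hb
        (by rw [h0, tsub_zero]; grind) hgt
      rw [close_waiting k1]
      refine ⟨⟨?_, ?_, ?_⟩, Or.inr ⟨k1, ?_, ?_⟩⟩ <;> grind
  · refine Eventually.of_forall fun r => ?_
    rw [follows_busy hb]
    obtain ⟨h1, h0, h0q⟩ | ⟨h01, h1q, h1⟩ := (close_busy hb).1 hz
    · have h02 := hsub (z.age 0) h0.le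
      have h00 : 0 < z.age 0 := by
        refine pos_of_ne_zero fun h => ?_
        rw [h, zero_add] at h0q
        exact absurd (h0q.trans_le hq) (by norm_num)
      obtain ⟨k1, k2, k3, k4, k5⟩ := outcome_busy_zero hb r (by
        rw [h1, tsub_zero]; exact tsub_lt_self two_pos h00)
      rw [close_ready k1]
      refine ⟨⟨?_, ?_, ?_, ?_⟩, Or.inl ⟨?_, k1, ?_, ?_⟩⟩ <;> grind
    · have h12 := hsub (z.age 1) h1.le
      have h02 := hsub (z.age 0) (h01.trans h1).le
      obtain ⟨k1, k2, k3, k4, k5⟩ := outcome_busy_one hb r (by grind)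
      rw [close_busy k1]
      refine ⟨Or.inl ⟨?_, ?_, ?_⟩, Or.inr ⟨?_, k1, ?_, ?_, ?_⟩⟩ <;> grind
  · obtain ⟨h02, h0, h0q⟩ := (close_waiting hb).1 hz
    have h02' := hsub (z.age 0) h0.le
    filter_upwards [ae_residualLaw_two (h02 ▸ h0) 0] with r ⟨hr, _, hr2, _⟩
    rw [follows_waiting hb]
    obtain ⟨k1, k2, k3, k4, k5⟩ := outcome_waiting (r := r) hb (by grind)
    rw [close_busy k1]
    refine ⟨Or.inl ⟨?_, ?_, ?_⟩, k1, ?_, ?_, ?_⟩ <;> grind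
  · exfalso
    obtain ⟨⟨b, h⟩, -⟩ | ⟨⟨b, h⟩, -⟩ | ⟨⟨b, h⟩, -⟩ := hz <;> rw [hb] at h <;> revert b <;> decide

theorem ae_step_close {q : ℝ≥0} (hq : q ≤ 1) {z : shiftExample.Config} (hz : z ∈ close q) :
    ∀ᵐ w ∂shiftExample.step z, w ∈ close q :=
  ae_step_shiftExample (measurableSet_close q) ((ae_outcome_close hq hz).mono fun _ h => h.1)

theorem ae_step_follows {z : shiftExample.Config} (hz : z ∈ close 1) :
    ∀ᵐ w ∂shiftExample.step z, Follows z w :=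
  ae_step_shiftExample (B := {w | Follows z w}) (measurable_prodMk_left measurableSet_follows)
    ((ae_outcome_close le_rfl hz).mono fun _ h => h.2)

/-! ### No invariant probability measure -/

/-- Ties are almost surely absent from runs, but an invariant measure might charge arbitrary
configurations. Truncated subtraction lets the hypothesis cover two overdue events as well. -/
theorem outcome_busy_tie {z : shiftExample.Config} {b : Bool} (hz : z.state = busy b) (r : ℝ≥0)
    (h : 2 - z.age 0 = 2 - z.age 1) : (outcome z r).state = 6 := by
  have hs : shiftExample.sched z.state = {0, 1} := by
    rw [hz]; cases b <;> simp [shiftExample, busy, exampleSched]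
  have hx : remaining z r 0 = remaining z r 1 := h
  have ht : shiftExample.firstTime z.state (remaining z r) = remaining z r 0 := by
    refine le_antisymm (Finset.inf'_le _ (by simp [hs])) (Finset.le_inf' _ _ fun e he => ?_)
    rw [hs] at he
    rcases Finset.mem_insert.1 he with rfl | he
    · exact le_rfl
    · rw [Finset.mem_singleton.1 he, hx]
  have hw : shiftExample.winners z.state (remaining z r) = {0, 1} := by
    ext e
    simp only [winners, ht, hs, Finset.mem_filter]
    constructor
    · exact fun h => h.1
    · intro he
      refine ⟨he, ?_⟩
      rcases Finset.mem_insert.1 he with rfl | he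
      · rfl
      · rw [Finset.mem_singleton.1 he, hx]
  rw [state_outcome, hw, hz]
  cases b <;> decide

theorem exampleTarget_waiting (b : Bool) (W : Finset (Fin 3)) :
    (∃ c, exampleTarget (waiting b) W = busy c) ∨ exampleTarget (waiting b) W = 6 := by
  revert b W; decide

theorem exampleTarget_ready (b : Bool) (W : Finset (Fin 3)) :
    (∃ c, exampleTarget (ready b) W = busy c) ∨ (∃ c, exampleTarget (ready b) W = waiting c) ∨
      exampleTarget (ready b) W = 6 := by
  revert b W; decide

section Invariant

variable {π : Measure shiftExample.Config} [IsProbabilityMeasure π]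

/-- A backward reachability rule: it suffices that from each point of Z a non-null set A of residual
times leads to a set already treated or to `close q`. -/
theorem ae_close_of_outcome (hπ : Kernel.Invariant shiftExample.step π) {q : ℝ≥0} (hq : q ≤ 1)
    {Y Z : Set shiftExample.Config} (hYm : MeasurableSet Y)
    (hY : ∀ᵐ z ∂π, z ∈ Y → z ∈ close q)
    (hZ : ∀ z ∈ Z, ∃ A, MeasurableSet A ∧ shiftExample.residualLaw 2 (z.age 2) A ≠ 0 ∧
      ∀ᵐ r ∂shiftExample.residualLaw 2 (z.age 2), r ∈ A → outcome z r ∈ Y ∪ close q) :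
    ∀ᵐ z ∂π, z ∈ Z → z ∈ close q := by
  refine shiftExample.ae_mem_of_step_ne_zero hπ (measurableSet_close q)
    (fun z hz => ae_step_close hq hz) hY fun z hz h0 => ?_
  obtain ⟨A, hA, hA0, h⟩ := hZ z hz
  exact hA0 (le_antisymm ((residualLaw_le_step z (hYm.union (measurableSet_close q)) hA h).trans
    h0.le) zero_le)

theorem ae_close_of_outcome' (hπ : Kernel.Invariant shiftExample.step π) {q : ℝ≥0} (hq : q ≤ 1)
    {Y Z : Set shiftExample.Config} (hYm : MeasurableSet Y)
    (hY : ∀ᵐ z ∂π, z ∈ Y → z ∈ close q)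
    (hZ : ∀ z ∈ Z, ∀ᵐ r ∂shiftExample.residualLaw 2 (z.age 2), outcome z r ∈ Y) :
    ∀ᵐ z ∂π, z ∈ Z → z ∈ close q :=
  ae_close_of_outcome hπ hq hYm hY fun z hz =>
    ⟨univ, MeasurableSet.univ, by simp, (hZ z hz).mono fun _ h _ => Or.inl h⟩

theorem ae_imp_union {α : Type*} [MeasurableSpace α] {μ : Measure α} {Y₁ Y₂ D : Set α}
    (h₁ : ∀ᵐ z ∂μ, z ∈ Y₁ → z ∈ D) (h₂ : ∀ᵐ z ∂μ, z ∈ Y₂ → z ∈ D) :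
    ∀ᵐ z ∂μ, z ∈ Y₁ ∪ Y₂ → z ∈ D := by
  filter_upwards [h₁, h₂] with z k₁ k₂ hz using hz.elim k₁ k₂

/-- Reachability is propagated backwards from `close q`: configurations with coherent ages come
first, then the restart and the ties, and finally whole states with arbitrary ages, since few steps
make the ages coherent. -/
theorem ae_close (hπ : Kernel.Invariant shiftExample.step π) {q : ℝ≥0} (hq : q ≤ 1)
    (hq0 : 0 < q) : ∀ᵐ z ∂π, z ∈ close q := by
  -- The uniform event may occur within the last q time units before event 0, and this makes the
  -- shift smaller than q.
  have h1 : ∀ᵐ z ∂π, z ∈ {w : shiftExample.Config | (∃ b, w.state = waiting b) ∧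
      w.age 0 = w.age 2 ∧ w.age 0 < 2} → z ∈ close q := by
    refine ae_close_of_outcome hπ hq MeasurableSet.empty (by simp) ?_
    rintro z ⟨⟨b, hb⟩, h02, h0⟩
    refine ⟨{r | 2 - q < z.age 2 + r}, measurableSet_lt measurable_const (by fun_prop),
      residualLaw_two_Ioi_ne_zero (h02 ▸ h0) (tsub_lt_self two_pos hq0), ?_⟩
    filter_upwards [ae_residualLaw_two (h02 ▸ h0) 0] with r ⟨_, _, hr2, _⟩ hr
    have hr : 2 - q < z.age 2 + r := hr
    obtain ⟨k1, k2, k3, k4, k5⟩ := outcome_waiting (r := r) hb (by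
      rw [lt_tsub_iff_left, h02]; exact hr2)
    right
    rw [close_busy k1, k3, h02]
    exact Or.inl ⟨k4, hr2, (tsub_lt_iff_right (hq.trans one_le_two)).1 hr⟩
  have h2 : ∀ᵐ z ∂π, z ∈ {w : shiftExample.Config | (∃ b, w.state = ready b) ∧
      w.age 0 = 0 ∧ w.age 2 = 0 ∧ 0 < w.age 1} → z ∈ close q := by
    refine ae_close_of_outcome hπ hq (measurableSet_setOfPred.2 (by fun_prop)) h1 ?_
    rintro z ⟨⟨b, hb⟩, h0, h2, h1⟩
    rw [h2]
    refine ⟨{r | 2 - z.age 1 < 0 + r}, measurableSet_lt measurable_const (by fun_prop),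
      residualLaw_two_Ioi_ne_zero two_pos (tsub_lt_self two_pos h1),
      Eventually.of_forall fun r hr => ?_⟩
    have hr : 2 - z.age 1 < r := by simpa using hr
    obtain ⟨k1, k2, k3, k4, k5⟩ := outcome_ready_one hb
      (by rw [h0, tsub_zero]; exact tsub_lt_self two_pos h1) hr
    rw [h0, zero_add] at k3
    rw [h2, zero_add] at k5
    exact Or.inl ⟨⟨b, k1⟩, k3.trans k5.symm, k3 ▸ tsub_lt_self two_pos h1⟩
  have h3 : ∀ᵐ z ∂π, z ∈ {w : shiftExample.Config | (∃ b, w.state = busy b) ∧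
      w.age 1 = 0 ∧ 0 < w.age 0 ∧ w.age 0 < 2} → z ∈ close q := by
    refine ae_close_of_outcome' hπ hq (measurableSet_setOfPred.2 (by fun_prop)) h2 ?_
    rintro z ⟨⟨b, hb⟩, h1, h0, h02⟩
    refine Eventually.of_forall fun r => ?_
    obtain ⟨k1, k2, k3, k4, k5⟩ := outcome_busy_zero hb r
      (by rw [h1, tsub_zero]; exact tsub_lt_self two_pos h0)
    refine ⟨⟨b, k1⟩, k3, k5, ?_⟩
    rw [k4]
    exact add_pos_of_nonneg_of_pos zero_le (tsub_pos_of_lt h02)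
  have h4 : ∀ᵐ z ∂π, z ∈ {w : shiftExample.Config | w.state = 6} → z ∈ close q := by
    refine ae_close_of_outcome' hπ hq (measurableSet_setOfPred.2 (by fun_prop)) h1 ?_
    intro z hz
    refine Eventually.of_forall fun r => ?_
    obtain ⟨k1, k2, k3⟩ := outcome_restart hz r
    exact ⟨⟨true, k1⟩, k2.trans k3.symm, k2 ▸ two_pos⟩
  have h5 : ∀ᵐ z ∂π, z ∈ {w : shiftExample.Config | (∃ b, w.state = busy b) ∧
      w.age 0 = w.age 1} → z ∈ close q := by
    refine ae_close_of_outcome' hπ hq (measurableSet_setOfPred.2 (by fun_prop)) h4 ?_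
    rintro z ⟨⟨b, hb⟩, h01⟩
    exact Eventually.of_forall fun r => outcome_busy_tie hb r (by rw [h01])
  -- With shift zero, events 0 and 1 stay synchronised; the resulting tie ends in the restart state.
  have h6 : ∀ᵐ z ∂π, z ∈ {w : shiftExample.Config | (∃ b, w.state = ready b) ∧
      w.age 0 = 0 ∧ w.age 1 = 0 ∧ w.age 2 = 0} → z ∈ close q := by
    refine ae_close_of_outcome' hπ hq (measurableSet_setOfPred.2 (by fun_prop)) h5 ?_
    rintro z ⟨⟨b, hb⟩, h0, h1, h2⟩
    rw [h2]
    filter_upwards [ae_residualLaw_two (a := 0) two_pos 0] with r ⟨_, _, hr, _⟩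
    rw [zero_add] at hr
    obtain ⟨k1, k2, k3, k4, k5⟩ := outcome_ready_two hb (by rw [h0, tsub_zero]; exact hr)
      (by rw [h1, tsub_zero]; exact hr)
    exact ⟨⟨b, k1⟩, by rw [k3, k4, h0, h1]⟩
  -- Whatever the ages, one step out of `busy` renews event 0 or event 1, or both at once through
  -- the restart, and lands in a set treated before.
  have h7 : ∀ᵐ z ∂π, z ∈ {w : shiftExample.Config | ∃ b, w.state = busy b} → z ∈ close q := by
    refine ae_close_of_outcome' hπ hq ?_ (ae_imp_union h2 (ae_imp_union h3 (ae_imp_union h4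
      (ae_imp_union h5 h6)))) ?_
    · refine .union ?_ (.union ?_ (.union ?_ (.union ?_ ?_))) <;>
        exact measurableSet_setOfPred.2 (by fun_prop)
    rintro z ⟨b, hb⟩
    refine Eventually.of_forall fun r => ?_
    rcases lt_trichotomy (2 - z.age 0) (2 - z.age 1) with hlt | heq | hgt
    · obtain ⟨k1, k2, k3, k4, k5⟩ := outcome_busy_zero hb r hlt
      rcases eq_zero_or_pos ((outcome z r).age 1) with h | h
      · exact Or.inr (Or.inr (Or.inr (Or.inr ⟨⟨b, k1⟩, k3, h, k5⟩)))
      · exact Or.inl ⟨⟨b, k1⟩, k3, k5, h⟩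
    · exact Or.inr (Or.inr (Or.inl (outcome_busy_tie hb r heq)))
    · obtain ⟨k1, k2, k3, k4, k5⟩ := outcome_busy_one hb r hgt
      rcases eq_zero_or_pos ((outcome z r).age 0) with h | h
      · exact Or.inr (Or.inr (Or.inr (Or.inl ⟨⟨b, k1⟩, h.trans k4.symm⟩)))
      · refine Or.inr (Or.inl ⟨⟨b, k1⟩, k4, h, ?_⟩)
        rw [k3]
        exact lt_tsub_iff_left.1 hgt
  have h8 : ∀ᵐ z ∂π, z ∈ {w : shiftExample.Config | ∃ b, w.state = waiting b} → z ∈ close q := by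
    refine ae_close_of_outcome' hπ hq ?_ (ae_imp_union h7 h4) ?_
    · refine .union ?_ ?_ <;> exact measurableSet_setOfPred.2 (by fun_prop)
    rintro z ⟨b, hb⟩
    refine Eventually.of_forall fun r => ?_
    have := exampleTarget_waiting b (shiftExample.winners z.state (remaining z r))
    rw [← hb, ← state_outcome] at this
    exact this
  have h9 : ∀ᵐ z ∂π, z ∈ {w : shiftExample.Config | ∃ b, w.state = ready b} → z ∈ close q := by
    refine ae_close_of_outcome' hπ hq ?_ (ae_imp_union h7 (ae_imp_union h8 h4)) ?_
    · refine .union ?_ (.union ?_ ?_) <;> exact measurableSet_setOfPred.2 (by fun_prop)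
    rintro z ⟨b, hb⟩
    refine Eventually.of_forall fun r => ?_
    have := exampleTarget_ready b (shiftExample.winners z.state (remaining z r))
    rw [← hb, ← state_outcome] at this
    exact this
  filter_upwards [h4, h7, h8, h9] with z k4 k7 k8 k9
  rcases shiftExample_state_cases z.state with h | h | h | h
  exacts [k9 h, k7 h, k8 h, k4 h]

/-- Membership forces a strictly positive shift, and this exceeds some 1/(n+1). -/
theorem exists_notMem_close (z : shiftExample.Config) :
    ∃ n : ℕ, z ∉ close (1 / ((n : ℝ≥0) + 1)) := by
  by_contra! h
  have key : ∀ c : ℝ≥0, 0 < c → ∃ n : ℕ, 1 / ((n : ℝ≥0) + 1) < c := fun c hc =>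
    exists_nat_one_div_lt hc
  rcases shiftExample_state_cases z.state with ⟨b, hb⟩ | ⟨b, hb⟩ | ⟨b, hb⟩ | hb
  · have h' := fun n => (close_ready hb).1 (h n)
    obtain ⟨n, hn⟩ := key _ (h' 0).2.2.1
    exact lt_asymm hn (h' n).2.2.2
  · have h' := fun n => (close_busy hb).1 (h n)
    by_cases h1 : z.age 1 = 0
    · have h'' : ∀ n : ℕ, z.age 0 < 2 ∧ 2 < z.age 0 + 1 / ((n : ℝ≥0) + 1) := fun n => by
        rcases h' n with h | h
        · exact h.2
        · rw [h1] at h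
          exact absurd h.1 not_lt_zero
      obtain ⟨n, hn⟩ := key _ (tsub_pos_of_lt (h'' 0).1)
      exact lt_asymm (lt_tsub_iff_left.1 hn) (h'' n).2
    · have h'' : ∀ n : ℕ, z.age 0 < z.age 1 ∧ z.age 1 < z.age 0 + 1 / ((n : ℝ≥0) + 1) :=
        fun n => by
          rcases h' n with h | h
          · exact absurd h.1 h1
          · exact ⟨h.1, h.2.1⟩
      obtain ⟨n, hn⟩ := key _ (tsub_pos_of_lt (h'' 0).1)
      exact lt_asymm (lt_tsub_iff_left.1 hn) (h'' n).2
  · have h' := fun n => (close_waiting hb).1 (h n)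
    obtain ⟨n, hn⟩ := key _ (tsub_pos_of_lt (h' 0).2.1)
    exact lt_asymm (lt_tsub_iff_left.1 hn) (h' n).2.2
  · obtain ⟨⟨b, h⟩, -⟩ | ⟨⟨b, h⟩, -⟩ | ⟨⟨b, h⟩, -⟩ := h 0 <;> rw [hb] at h <;> revert b <;> decide

theorem not_invariant_shiftExample : ¬ Kernel.Invariant shiftExample.step π := by
  intro hπ
  have h : ∀ᵐ z ∂π, ∀ n : ℕ, z ∈ close (1 / ((n : ℝ≥0) + 1)) := ae_all_iff.2 fun n =>
    ae_close hπ (by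
      rw [div_le_one (by positivity)]
      exact le_add_of_nonneg_left zero_le) (by positivity)
  obtain ⟨z, hz⟩ := h.exists
  obtain ⟨n, hn⟩ := exists_notMem_close z
  exact hn (hz n)

end Invariant

/-! ### The almost sure shape of a run: rounds of three steps -/

theorem runMeasure_inter_succ {S E : Type} [Fintype S] [Fintype E] [MeasurableSpace S]
    [DiscreteMeasurableSpace S] (G : GSMP S E) {n : ℕ} {A : Set (ℕ → G.Config)}
    (hA : MeasurableSet[G.past n] A) {C : Set G.Config} (hC : MeasurableSet C) :
    G.runMeasure (A ∩ {σ | σ (n + 1) ∈ C}) = ∫⁻ σ in A, G.step (σ n) C ∂G.runMeasure := by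
  have h := G.setLIntegral_past_succ hA (g := fun _ w => C.indicator (fun _ => 1) w)
    ((measurable_const.indicator hC).comp measurable_snd)
  have hC' : MeasurableSet {σ : ℕ → G.Config | σ (n + 1) ∈ C} := measurable_pi_apply (n + 1) hC
  calc G.runMeasure (A ∩ {σ | σ (n + 1) ∈ C})
      = ∫⁻ σ in A, {σ : ℕ → G.Config | σ (n + 1) ∈ C}.indicator (fun _ => 1) σ ∂G.runMeasure := by
        rw [lintegral_indicator_const hC', one_mul, Measure.restrict_apply hC', inter_comm]
    _ = ∫⁻ σ in A, ∫⁻ w, C.indicator (fun _ => 1) w ∂G.step (σ n) ∂G.runMeasure := h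
    _ = _ := by simp_rw [lintegral_indicator_const hC, one_mul]

/-- The runs that use only the transitions of `Follows`. -/
structure Regular (σ : ℕ → shiftExample.Config) : Prop where
  state_zero : (σ 0).state = waiting true
  age_zero : (σ 0).age 0 = 0
  mem_close : ∀ n, σ (n + 1) ∈ close 1
  follows : ∀ n, Follows (σ n) (σ (n + 1))

theorem ae_run_zero : ∀ᵐ σ ∂shiftExample.runMeasure,
    (σ 0).state = waiting true ∧ (σ 0).age 0 = 0 ∧ (σ 0).age 2 = 0 := by
  have h : ∀ᵐ z ∂shiftExample.runMeasure.map (fun σ => σ 0),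
      (z.state = waiting true ∧ z.age 0 = 0 ∧ z.age 2 = 0) := by
    rw [runMeasure_map_zero, initMeasure]
    rw [ae_map_iff (measurable_of_countable _).aemeasurable
      (measurableSet_setOfPred.2 (by fun_prop))]
    change ∀ᵐ s ∂(PMF.pure (2 : Fin 7)).toMeasure, _
    rw [PMF.toMeasure_pure, ae_dirac_eq]
    exact ⟨rfl, rfl, rfl⟩
  exact ae_of_ae_map (measurable_pi_apply 0).aemeasurable h

/-- The initial configuration is not in `close 1`, because event 0 has age 0 there; the first delay
exceeds 1 and brings the run into that set. -/
theorem ae_outcome_zero {z : shiftExample.Config} (hb : z.state = waiting true)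
    (h0 : z.age 0 = 0) (h2 : z.age 2 = 0) :
    ∀ᵐ r ∂shiftExample.residualLaw 2 (z.age 2),
      (outcome z r ∈ close 1 ∧ Follows z (outcome z r)) ∧ (outcome z r).age 0 = r := by
  rw [h2]
  filter_upwards [ae_residualLaw_two (a := 0) two_pos 0] with r ⟨h0r, hr1, hr2, _⟩
  rw [zero_add] at hr1 hr2
  obtain ⟨k1, k2, k3, k4, k5⟩ := outcome_waiting (r := r) hb (by rw [h0, tsub_zero]; exact hr2)
  rw [h0, zero_add] at k3
  rw [follows_waiting hb, close_busy k1, k3, h0, k2]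
  refine ⟨⟨Or.inl ⟨k4, hr2, ?_⟩, k1, k4, (zero_add _).symm, h0r⟩, rfl⟩
  rw [← one_add_one_eq_two]
  exact add_lt_add_left hr1 1

theorem ae_run_close (n : ℕ) : ∀ᵐ σ ∂shiftExample.runMeasure, σ (n + 1) ∈ close 1 := by
  have hQ : MeasurableSet {p : shiftExample.Config × shiftExample.Config | p.2 ∈ close 1} :=
    (measurableSet_close 1).preimage measurable_snd
  induction n with
  | zero =>
    exact shiftExample.ae_runMeasure_succ (n := 0)
      (P := fun z => z.state = waiting true ∧ z.age 0 = 0 ∧ z.age 2 = 0)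
      (Q := fun _ w => w ∈ close 1) ae_run_zero hQ fun z hz =>
        ae_step_shiftExample (measurableSet_close 1)
          ((ae_outcome_zero hz.1 hz.2.1 hz.2.2).mono fun _ h => h.1.1)
  | succ n ih =>
    exact shiftExample.ae_runMeasure_succ (n := n + 1) (P := fun z => z ∈ close 1)
      (Q := fun _ w => w ∈ close 1) ih hQ fun z hz => ae_step_close le_rfl hz

theorem ae_run_follows (n : ℕ) :
    ∀ᵐ σ ∂shiftExample.runMeasure, Follows (σ n) (σ (n + 1)) := by
  cases n with
  | zero =>
    exact shiftExample.ae_runMeasure_succ (n := 0)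
      (P := fun z => z.state = waiting true ∧ z.age 0 = 0 ∧ z.age 2 = 0)
      (Q := Follows) ae_run_zero measurableSet_follows fun z hz =>
        ae_step_shiftExample (B := {w | Follows z w}) (measurable_prodMk_left measurableSet_follows)
          ((ae_outcome_zero hz.1 hz.2.1 hz.2.2).mono fun _ h => h.1.2)
  | succ n =>
    exact shiftExample.ae_runMeasure_succ (n := n + 1) (P := fun z => z ∈ close 1)
      (Q := Follows) (ae_run_close n) measurableSet_follows fun z hz => ae_step_follows hz

theorem ae_regular : ∀ᵐ σ ∂shiftExample.runMeasure, Regular σ := by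
  filter_upwards [ae_all_iff.2 ae_run_close, ae_all_iff.2 ae_run_follows, ae_run_zero]
    with σ h1 h2 h0
  exact ⟨h0.1, h0.2.1, h1, h2⟩

/-- The delay of the uniform event in the `k`-th round. -/
def delay (k : ℕ) (σ : ℕ → shiftExample.Config) : ℝ≥0 :=
  open Classical in
  if ∃ b, (σ (3 * k)).state = busy b then (σ (3 * k)).age 0 else (σ (3 * k + 1)).age 0

/-- Step 3k+1 precedes the configuration of index 3k+2, from which the next delay is drawn; this is
the gap needed for independence. -/
theorem measurable_delay (k : ℕ) : Measurable[shiftExample.past (3 * k + 1)] (delay k) := by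
  refine Measurable.ite ?_ ?_ ?_
  · exact shiftExample.measurable_eval_past (k := 3 * k) (n := 3 * k + 1) (by omega)
      (measurableSet_setOfPred.2 (by fun_prop) :
        MeasurableSet {z : shiftExample.Config | ∃ b, z.state = busy b})
  · exact (shiftExample.measurable_age 0).comp (shiftExample.measurable_eval_past (by omega))
  · exact (shiftExample.measurable_age 0).comp (shiftExample.measurable_eval_past le_rfl)

/-- What happens between step `3 * k + 2` and step `3 * k + 5`. -/
theorem Regular.round {σ : ℕ → shiftExample.Config} (hσ : Regular σ) {k : ℕ} {b : Bool}
    (hb : (σ (3 * k + 2)).state = ready b) :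
    (((σ (3 * k + 3)).state = busy b ∧ (σ (3 * k + 4)).state = busy b ∧
        (σ (3 * k + 5)).state = ready b ∧ delay (k + 1) σ + (σ (3 * k + 2)).age 1 < 2 ∧
        (σ (3 * k + 5)).age 1 = (σ (3 * k + 2)).age 1) ∨
      ((σ (3 * k + 3)).state = waiting b ∧ (σ (3 * k + 4)).state = busy !b ∧
        (σ (3 * k + 5)).state = ready !b ∧ 2 < delay (k + 1) σ + (σ (3 * k + 2)).age 1 ∧
        (σ (3 * k + 5)).age 1 + delay (k + 1) σ = 2)) ∧
    1 ≤ (σ (3 * k + 3)).last ∧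
      (σ (3 * k + 3)).last + (σ (3 * k + 4)).last + (σ (3 * k + 5)).last = 2 := by
  have c2 := hσ.mem_close (3 * k + 1)
  have c3 := hσ.mem_close (3 * k + 2)
  have f3 := hσ.follows (3 * k + 2)
  have f4 := hσ.follows (3 * k + 3)
  have f5 := hσ.follows (3 * k + 4)
  obtain ⟨h0, h2, h1, h1q⟩ := (close_ready hb).1 c2
  rcases (follows_ready hb).1 f3 with ⟨k1, k2, k3, k4⟩ | ⟨k1, k2, k3⟩
  · have hd : delay (k + 1) σ = (σ (3 * k + 3)).age 0 := if_pos ⟨b, k1⟩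
    rw [close_busy k1] at c3
    rw [follows_busy k1] at f4
    obtain ⟨l1, l2, l3, l4, l5⟩ : 0 < (σ (3 * k + 3)).age 1 ∧ (σ (3 * k + 4)).state = busy b ∧
        (σ (3 * k + 4)).last + (σ (3 * k + 3)).age 1 = 2 ∧ (σ (3 * k + 4)).age 1 = 0 ∧
        (σ (3 * k + 4)).age 0 = (σ (3 * k + 3)).age 0 + (σ (3 * k + 4)).last := by
      rcases f4 with h | h
      · grind
      · exact h
    rw [follows_busy l2] at f5
    obtain ⟨-, m1, m2, m3⟩ : (σ (3 * k + 4)).age 1 = 0 ∧ (σ (3 * k + 5)).state = ready b ∧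
        (σ (3 * k + 5)).last + (σ (3 * k + 4)).age 0 = 2 ∧
        (σ (3 * k + 5)).age 1 + (σ (3 * k + 4)).age 0 = 2 := by
      rcases f5 with h | h
      · exact h
      · grind
    refine ⟨Or.inl ⟨k1, l2, m1, ?_, ?_⟩, ?_, ?_⟩ <;> grind
  · have hd : delay (k + 1) σ = (σ (3 * k + 4)).age 0 := if_neg (by
      rintro ⟨c, hc⟩
      exact busy_ne_waiting _ _ (hc.symm.trans k1))
    rw [follows_waiting k1] at f4
    obtain ⟨l2, l4, l5, l6⟩ : (σ (3 * k + 4)).state = busy !b ∧ (σ (3 * k + 4)).age 1 = 0 ∧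
        (σ (3 * k + 4)).age 0 = (σ (3 * k + 3)).age 0 + (σ (3 * k + 4)).last ∧
        0 < (σ (3 * k + 4)).last := f4
    rw [follows_busy l2] at f5
    obtain ⟨-, m1, m2, m3⟩ : (σ (3 * k + 4)).age 1 = 0 ∧ (σ (3 * k + 5)).state = ready !b ∧
        (σ (3 * k + 5)).last + (σ (3 * k + 4)).age 0 = 2 ∧
        (σ (3 * k + 5)).age 1 + (σ (3 * k + 4)).age 0 = 2 := by
      rcases f5 with h | h
      · exact h
      · grind
    -- The shift is less than 1, so event 1 is not due before time 1 of the round. This lower bound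
    -- on the stay in `ready` is what the timed frequency uses.
    have hl : 1 ≤ (σ (3 * k + 3)).last := by
      have : 1 + (σ (3 * k + 2)).age 1 ≤ (σ (3 * k + 3)).last + (σ (3 * k + 2)).age 1 := by
        rw [k3]
        calc 1 + (σ (3 * k + 2)).age 1 ≤ 1 + 1 := by gcongr
          _ = 2 := one_add_one_eq_two
      exact le_of_add_le_add_right this
    refine ⟨Or.inr ⟨k1, l2, m1, ?_, ?_⟩, hl, ?_⟩ <;> grind

theorem Regular.start {σ : ℕ → shiftExample.Config} (hσ : Regular σ) :
    (σ 1).state = busy false ∧ (σ 2).state = ready false ∧ (σ 2).age 1 + delay 0 σ = 2 := by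
  have f1 := (follows_waiting hσ.state_zero).1 (hσ.follows 0)
  obtain ⟨k1, k2, k3, k4⟩ := f1
  have hd : delay 0 σ = (σ 1).age 0 := if_neg (by
    rintro ⟨c, hc⟩
    exact busy_ne_waiting _ _ (hc.symm.trans hσ.state_zero))
  rcases (follows_busy k1).1 (hσ.follows 1) with h | h
  · exact ⟨k1, h.2.1, hd ▸ h.2.2.2⟩
  · exact absurd k2 h.1.ne'

theorem Regular.exists_ready {σ : ℕ → shiftExample.Config} (hσ : Regular σ) (k : ℕ) :
    ∃ b, (σ (3 * k + 2)).state = ready b := by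
  induction k with
  | zero => exact ⟨false, hσ.start.2.1⟩
  | succ k ih =>
    obtain ⟨b, hb⟩ := ih
    rcases (hσ.round hb).1 with h | h
    · exact ⟨b, h.2.2.1⟩
    · exact ⟨!b, h.2.2.1⟩

/-! ### Independence of the delays -/

/-- The configurations in which the uniform event has occurred before the second event. -/
def busySet : Set shiftExample.Config := {w | ∃ b, w.state = busy b}

theorem measurableSet_busySet : MeasurableSet busySet :=
  measurableSet_setOfPred.2 (by fun_prop)

/-- Events 0 and 2 were scheduled together, so the age of event 0 when event 2 occurs is the
complete uniform delay. -/
theorem step_waiting {z : shiftExample.Config} {b : Bool} (hb : z.state = waiting b)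
    (h02 : z.age 0 = z.age 2) (h0 : z.age 0 < 2) {B : Set ℝ≥0} (hB : MeasurableSet B) :
    shiftExample.step z {w | w.age 0 ∈ B} =
      shiftExample.residualLaw 2 (z.age 0) {r | z.age 0 + r ∈ B} := by
  have h := step_shiftExample_apply z (B := {w | w.age 0 ∈ B}) (A := {r | z.age 0 + r ∈ B})
    (shiftExample.measurable_age 0 hB)
    (hB.preimage (by fun_prop : Measurable fun r : ℝ≥0 => z.age 0 + r)) (by
      filter_upwards [ae_residualLaw_two (h02 ▸ h0) 0] with r ⟨_, _, hr2, _⟩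
      obtain ⟨k1, k2, k3, k4, k5⟩ := outcome_waiting (r := r) hb (by
        rw [lt_tsub_iff_left, h02]; exact hr2)
      simp only [k3])
  rw [h, h02]

theorem step_ready_busy {z : shiftExample.Config} {b : Bool} (hb : z.state = ready b)
    (hz : z ∈ close 1) {B : Set ℝ≥0} (hB : MeasurableSet B) :
    shiftExample.step z (busySet ∩ {w | w.age 0 ∈ B}) = uniformLaw (Iio (2 - z.age 1) ∩ B) := by
  obtain ⟨h0, h2, h1, h1q⟩ := (close_ready hb).1 hz
  rw [uniformLaw, ← h2]
  refine step_shiftExample_apply z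
    (measurableSet_busySet.inter (shiftExample.measurable_age 0 hB)) (measurableSet_Iio.inter hB) ?_
  rw [h2]
  filter_upwards [ae_residualLaw_two (a := 0) two_pos (2 - z.age 1)] with r ⟨_, _, hr2, hr⟩
  rw [zero_add] at hr2
  rcases hr.lt_or_gt with hlt | hgt
  · obtain ⟨k1, k2, k3, k4, k5⟩ := outcome_ready_two hb (by rw [h0, tsub_zero]; exact hr2) hlt
    rw [h0, zero_add] at k3
    simp [busySet, k1, k3, hlt, busy_injective.eq_iff]
  · obtain ⟨k1, k2, k3, k4, k5⟩ := outcome_ready_one hb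
      (by rw [h0, tsub_zero]; exact tsub_lt_self two_pos h1) hgt
    simp [busySet, k1, hgt.le, (busy_ne_waiting _ _).symm]

/-- The contribution of the delays that outlast event 1: first survival up to a = 2 - d, where d is
the shift, then a fresh residual draw at age a. Added to `step_ready_busy` it gives the left side of
`uniformLaw_split`. -/
theorem lintegral_step_ready {z : shiftExample.Config} {b : Bool} (hb : z.state = ready b)
    (hz : z ∈ close 1) {B : Set ℝ≥0} (hB : MeasurableSet B) :
    ∫⁻ w, busySetᶜ.indicator (fun w => shiftExample.step w {w | w.age 0 ∈ B}) w
        ∂shiftExample.step z =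
      uniformLaw (Ioi (2 - z.age 1)) *
        shiftExample.residualLaw 2 (2 - z.age 1) {r | 2 - z.age 1 + r ∈ B} := by
  obtain ⟨h0, h2, h1, h1q⟩ := (close_ready hb).1 hz
  have hm : Measurable (busySetᶜ.indicator fun w => shiftExample.step w {w | w.age 0 ∈ B}) :=
    (shiftExample.step.measurable_coe (shiftExample.measurable_age 0 hB)).indicator
      measurableSet_busySet.compl
  rw [lintegral_step_shiftExample z hm, h2, mul_comm, ← lintegral_indicator_const measurableSet_Ioi]
  refine lintegral_congr_ae ?_
  filter_upwards [ae_residualLaw_two (a := 0) two_pos (2 - z.age 1)] with r ⟨_, _, hr2, hr⟩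
  rw [zero_add] at hr2
  rcases hr.lt_or_gt with hlt | hgt
  · obtain ⟨k1, k2, k3, k4, k5⟩ := outcome_ready_two hb (by rw [h0, tsub_zero]; exact hr2) hlt
    rw [indicator_of_notMem (by simp [busySet, k1, busy_injective.eq_iff]),
      indicator_of_notMem (by simpa using hlt.le)]
  · obtain ⟨k1, k2, k3, k4, k5⟩ := outcome_ready_one hb
      (by rw [h0, tsub_zero]; exact tsub_lt_self two_pos h1) hgt
    rw [h0, zero_add] at k3
    rw [h2, zero_add] at k5
    rw [indicator_of_mem (by simp [busySet, k1, (busy_ne_waiting _ _).symm]),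
      indicator_of_mem (by exact hgt), step_waiting k1 (k3.trans k5.symm)
      (k3 ▸ tsub_lt_self two_pos h1) hB, k3]

/-- Given the past, the shift decides at which step the delay is revealed, but the two cases always
add up to the same uniform law. -/
theorem runMeasure_inter_delay_succ (k : ℕ) {A : Set (ℕ → shiftExample.Config)}
    (hA : MeasurableSet[shiftExample.past (3 * k + 1)] A) {B : Set ℝ≥0} (hB : MeasurableSet B) :
    shiftExample.runMeasure (A ∩ {σ | delay (k + 1) σ ∈ B}) =
      uniformLaw B * shiftExample.runMeasure A := by
  have hA2 : MeasurableSet[shiftExample.past (3 * k + 2)] A :=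
    shiftExample.past_mono (by omega) _ hA
  have hA3 : MeasurableSet[shiftExample.past (3 * k + 3)] A :=
    shiftExample.past_mono (by omega) _ hA
  have hAm : MeasurableSet A := shiftExample.past_le _ _ hA
  have hage : MeasurableSet {w : shiftExample.Config | w.age 0 ∈ B} :=
    shiftExample.measurable_age 0 hB
  have hbusy : MeasurableSet[shiftExample.past (3 * k + 3)]
      {σ : ℕ → shiftExample.Config | σ (3 * k + 3) ∈ busySetᶜ} :=
    shiftExample.measurable_eval_past le_rfl measurableSet_busySet.compl
  -- The delay is read off at step 3k+3 if event 2 occurs before event 1, and one step later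
  -- otherwise.
  have hsplit : A ∩ {σ | delay (k + 1) σ ∈ B} =
      A ∩ {σ | σ (3 * k + 2 + 1) ∈ busySet ∩ {w | w.age 0 ∈ B}} ∪
        (A ∩ {σ | σ (3 * k + 3) ∈ busySetᶜ}) ∩ {σ | σ (3 * k + 3 + 1) ∈ {w | w.age 0 ∈ B}} := by
    ext σ
    by_cases h : σ (3 * k + 3) ∈ busySet
    · have hd : delay (k + 1) σ = (σ (3 * k + 3)).age 0 := if_pos h
      simp [hd, h]
    · have hd : delay (k + 1) σ = (σ (3 * k + 4)).age 0 := if_neg h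
      simp [hd, h]
  have hdisj : Disjoint (A ∩ {σ | σ (3 * k + 2 + 1) ∈ busySet ∩ {w | w.age 0 ∈ B}})
      ((A ∩ {σ | σ (3 * k + 3) ∈ busySetᶜ}) ∩ {σ | σ (3 * k + 3 + 1) ∈ {w | w.age 0 ∈ B}}) :=
    Set.disjoint_left.2 fun σ h h' => h'.1.2 h.2.1
  have hm : MeasurableSet
      ((A ∩ {σ | σ (3 * k + 3) ∈ busySetᶜ}) ∩ {σ | σ (3 * k + 3 + 1) ∈ {w | w.age 0 ∈ B}}) :=
    (hAm.inter (shiftExample.past_le _ _ hbusy)).inter (measurable_pi_apply (3 * k + 3 + 1) hage)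
  have hst : Measurable fun w => shiftExample.step w {w | w.age 0 ∈ B} :=
    shiftExample.step.measurable_coe hage
  rw [hsplit, measure_union hdisj hm,
    shiftExample.runMeasure_inter_succ hA2 (measurableSet_busySet.inter hage),
    shiftExample.runMeasure_inter_succ (hA3.inter hbusy) hage]
  -- The Markov property once more, from step 3k+3 back to the start of the round at 3k+2.
  have e1 : ∫⁻ σ in A ∩ {σ | σ (3 * k + 3) ∈ busySetᶜ},
        shiftExample.step (σ (3 * k + 3)) {w | w.age 0 ∈ B} ∂shiftExample.runMeasure =
      ∫⁻ σ in A, ∫⁻ w, busySetᶜ.indicator (fun w => shiftExample.step w {w | w.age 0 ∈ B}) w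
        ∂shiftExample.step (σ (3 * k + 2)) ∂shiftExample.runMeasure := by
    rw [← shiftExample.setLIntegral_past_succ hA2
      (g := fun _ w => busySetᶜ.indicator (fun w => shiftExample.step w {w | w.age 0 ∈ B}) w)
      ((hst.indicator measurableSet_busySet.compl).comp measurable_snd), inter_comm,
      ← Measure.restrict_restrict (shiftExample.past_le _ _ hbusy),
      ← lintegral_indicator (shiftExample.past_le _ _ hbusy)]
    rfl
  have hsm : Measurable fun σ : ℕ → shiftExample.Config =>
      shiftExample.step (σ (3 * k + 2)) (busySet ∩ {w | w.age 0 ∈ B}) :=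
    (shiftExample.step.measurable_coe (measurableSet_busySet.inter hage)).comp
      (measurable_pi_apply (3 * k + 2))
  rw [e1, ← lintegral_add_left hsm, ← setLIntegral_const]
  refine setLIntegral_congr_fun_ae hAm ?_
  filter_upwards [ae_regular] with σ hσ _
  obtain ⟨b, hb⟩ := hσ.exists_ready k
  have hc := hσ.mem_close (3 * k + 1)
  rw [step_ready_busy hb hc hB, lintegral_step_ready hb hc hB]
  exact uniformLaw_split (tsub_lt_self two_pos ((close_ready hb).1 hc).2.2.1) hB

theorem runMeasure_delay_zero {B : Set ℝ≥0} (hB : MeasurableSet B) :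
    shiftExample.runMeasure {σ | delay 0 σ ∈ B} = uniformLaw B := by
  have hage : MeasurableSet {w : shiftExample.Config | w.age 0 ∈ B} :=
    shiftExample.measurable_age 0 hB
  have h := shiftExample.runMeasure_inter_succ (n := 0) (A := univ) MeasurableSet.univ hage
  rw [univ_inter, Measure.restrict_univ] at h
  have e : shiftExample.runMeasure {σ | delay 0 σ ∈ B} =
      shiftExample.runMeasure {σ | σ (0 + 1) ∈ {w | w.age 0 ∈ B}} := by
    refine measure_congr ?_
    filter_upwards [ae_run_zero] with σ hσ
    have hd : delay 0 σ = (σ 1).age 0 := if_neg (by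
      rintro ⟨c, hc⟩
      exact busy_ne_waiting _ _ (hc.symm.trans hσ.1))
    apply propext
    change delay 0 σ ∈ B ↔ (σ 1).age 0 ∈ B
    rw [hd]
  rw [e, h]
  calc ∫⁻ σ, shiftExample.step (σ 0) {w | w.age 0 ∈ B} ∂shiftExample.runMeasure
      = ∫⁻ _, uniformLaw B ∂shiftExample.runMeasure := by
        refine lintegral_congr_ae ?_
        filter_upwards [ae_run_zero] with σ ⟨h1, h0, h2⟩
        rw [step_waiting h1 (h0.trans h2.symm) (h0 ▸ two_pos) hB, h0]
        simp
    _ = uniformLaw B := by simp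

/-- The delays of the uniform event in the successive rounds are independent. -/
theorem runMeasure_delays (B : ℕ → Set ℝ≥0) (hB : ∀ k, MeasurableSet (B k)) (n : ℕ) :
    MeasurableSet[shiftExample.past (3 * n + 1)] {σ | ∀ k ≤ n, delay k σ ∈ B k} ∧
      shiftExample.runMeasure {σ | ∀ k ≤ n, delay k σ ∈ B k} =
        ∏ k ∈ Finset.range (n + 1), uniformLaw (B k) := by
  induction n with
  | zero =>
    have : {σ : ℕ → shiftExample.Config | ∀ k ≤ 0, delay k σ ∈ B k} = {σ | delay 0 σ ∈ B 0} := by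
      ext; simp
    rw [this]
    exact ⟨measurable_delay 0 (hB 0), by simp [runMeasure_delay_zero (hB 0)]⟩
  | succ n ih =>
    have : {σ : ℕ → shiftExample.Config | ∀ k ≤ n + 1, delay k σ ∈ B k} =
        {σ | ∀ k ≤ n, delay k σ ∈ B k} ∩ {σ | delay (n + 1) σ ∈ B (n + 1)} := by
      ext σ
      simp [Nat.le_succ_iff, or_imp, forall_and]
    rw [this, runMeasure_inter_delay_succ n ih.1 (hB _), ih.2,
      Finset.prod_range_succ _ (n + 1), mul_comm (uniformLaw _)]
    exact ⟨(shiftExample.past_mono (by omega) _ ih.1).inter (measurable_delay (n + 1) (hB _)), rfl⟩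

/-! ### Two records at comparable times, with positive probability -/

/-- The delays for which, up to round `6 * m`, the shift falls below `2 / m` in round `i` and below
`1 / m` in round `j`, and in no other round. -/
def recordSet (m i j k : ℕ) : Set ℝ≥0 :=
  if k = i then Ioc (2 - 2 / (m : ℝ≥0)) (2 - 1 / (m : ℝ≥0))
  else if k = j then Ioc (2 - 1 / (m : ℝ≥0)) 2
  else Iic (2 - 2 / (m : ℝ≥0))

theorem recordSet_first (m i j : ℕ) :
    recordSet m i j i = Ioc (2 - 2 / (m : ℝ≥0)) (2 - 1 / (m : ℝ≥0)) :=
  if_pos rfl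

theorem recordSet_second (m : ℕ) {i j : ℕ} (h : j ≠ i) :
    recordSet m i j j = Ioc (2 - 1 / (m : ℝ≥0)) 2 :=
  (if_neg h).trans (if_pos rfl)

theorem recordSet_other (m : ℕ) {i j k : ℕ} (hi : k ≠ i) (hj : k ≠ j) :
    recordSet m i j k = Iic (2 - 2 / (m : ℝ≥0)) :=
  (if_neg hi).trans (if_neg hj)

theorem measurableSet_recordSet (m i j k : ℕ) : MeasurableSet (recordSet m i j k) := by
  unfold recordSet
  split_ifs
  exacts [measurableSet_Ioc, measurableSet_Ioc, measurableSet_Iic]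

/-- The runs whose delays up to round `6 * m` lie in `recordSet m i j`. -/
def recordEvent (m i j : ℕ) : Set (ℕ → shiftExample.Config) :=
  {σ | ∀ k ≤ 6 * m, delay k σ ∈ recordSet m i j k}

theorem measurableSet_recordEvent (m i j : ℕ) : MeasurableSet (recordEvent m i j) :=
  shiftExample.past_le _ _
    (runMeasure_delays (recordSet m i j) (measurableSet_recordSet m i j) (6 * m)).1

/-- By independence the rounds i and j contribute 1/m each, and the other 6m - 1 rounds 1 - 2/m
each; the exponent 6m is a harmless weakening. -/
theorem le_runMeasure_recordEvent {m i j : ℕ} (hm : 2 ≤ m) (hij : i ≠ j) (hi : i ≤ 6 * m)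
    (hj : j ≤ 6 * m) :
    (((1 / (m : ℝ≥0)) ^ 2 * (1 - 2 / (m : ℝ≥0)) ^ (6 * m) : ℝ≥0) : ℝ≥0∞) ≤
      shiftExample.runMeasure (recordEvent m i j) := by
  rw [recordEvent, (runMeasure_delays (recordSet m i j) (measurableSet_recordSet m i j) (6 * m)).2]
  have hm0 : (0 : ℝ≥0) < m := by exact_mod_cast (by omega : 0 < m)
  have h2 : 2 / (m : ℝ≥0) ≤ 1 := by
    rw [div_le_one hm0]
    exact_mod_cast hm
  have h12 : 2 / (m : ℝ≥0) = 1 / m + 1 / m := by rw [← add_div, one_add_one_eq_two]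
  have h21 : (2 : ℝ≥0) = 1 + 1 := one_add_one_eq_two.symm
  have h1 : 1 / (m : ℝ≥0) ≤ 1 := by rw [h12] at h2; exact le_of_add_le_left h2
  set p := 1 / (m : ℝ≥0) with hp
  set q := 2 / (m : ℝ≥0) with hq
  have hq2 : q ≤ 2 := h2.trans one_le_two
  have hp2 : p ≤ 2 := h1.trans one_le_two
  have ei : uniformLaw (recordSet m i j i) = p := by
    rw [recordSet_first, uniformLaw_Ioc (by rw [le_tsub_iff_right hq2]; grind)
      tsub_le_self]
    congr 1
    rw [tsub_tsub_tsub_cancel_left hq2, h12, add_tsub_cancel_right]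
  have ej : uniformLaw (recordSet m i j j) = p := by
    rw [recordSet_second m hij.symm,
      uniformLaw_Ioc (by rw [le_tsub_iff_right hp2]; grind) le_rfl]
    congr 1
    rw [tsub_tsub_cancel_of_le hp2]
  have ek : ∀ k, k ≠ i → k ≠ j → uniformLaw (recordSet m i j k) = (1 - q : ℝ≥0) := by
    intro k hki hkj
    rw [recordSet_other m hki hkj, uniformLaw_Iic tsub_le_self]
    congr 1
    rw [tsub_right_comm]
    congr 1
    exact tsub_eq_of_eq_add h21
  have hir : i ∈ Finset.range (6 * m + 1) := Finset.mem_range.2 (by omega)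
  have hjr : j ∈ (Finset.range (6 * m + 1)).erase i :=
    Finset.mem_erase.2 ⟨hij.symm, Finset.mem_range.2 (by omega)⟩
  rw [← Finset.mul_prod_erase _ _ hir, ← Finset.mul_prod_erase _ _ hjr, ei, ej,
    Finset.prod_congr rfl (g := fun _ => ((1 - q : ℝ≥0) : ℝ≥0∞)) fun k hk => ?_]
  · rw [Finset.prod_const, Finset.card_erase_of_mem hjr, Finset.card_erase_of_mem hir,
      Finset.card_range]
    rw [sq, mul_assoc, ← ENNReal.coe_pow, ← ENNReal.coe_mul, ← ENNReal.coe_mul,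
      ENNReal.coe_le_coe]
    exact mul_le_mul' le_rfl (mul_le_mul' le_rfl (pow_le_pow_of_le_one zero_le
      (tsub_le_self : 1 - q ≤ 1) (by omega : 6 * m + 1 - 1 - 1 ≤ 6 * m)))
  · rw [Finset.mem_erase, Finset.mem_erase] at hk
    exact ek k hk.2.1 hk.1

/-- The two rounds with a new minimum lie in `[m, 2 * m)` and `[3 * m, 4 * m)`. -/
def recordIndices (m : ℕ) : Finset (ℕ × ℕ) :=
  Finset.Ico m (2 * m) ×ˢ Finset.Ico (3 * m) (4 * m)

/-- The pair can be read off from the run: i and j are the only rounds in [m, 2m) and [3m, 4m) whose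
delay exceeds 2 - 2/m. -/
theorem disjoint_recordEvent {m : ℕ} {x y : ℕ × ℕ} (hx : x ∈ recordIndices m)
    (hy : y ∈ recordIndices m) (hxy : x ≠ y) :
    Disjoint (recordEvent m x.1 x.2) (recordEvent m y.1 y.2) := by
  obtain ⟨i, j⟩ := x
  obtain ⟨i', j'⟩ := y
  simp only [recordIndices, Finset.mem_product, Finset.mem_Ico] at hx hy
  rw [Set.disjoint_left]
  intro σ h h'
  by_cases hi : i = i'
  · have hj : j ≠ j' := fun hj => hxy (by rw [hi, hj])
    have h1 : delay j σ ∈ recordSet m i j j := h j (by omega)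
    have h2 : delay j σ ∈ recordSet m i' j' j := h' j (by omega)
    rw [recordSet_second m (by omega)] at h1
    rw [recordSet_other m (by omega) hj] at h2
    refine absurd (h1.1.trans_le h2) (not_lt.2 (tsub_le_tsub_left ?_ 2))
    gcongr
    exact one_le_two
  · have h1 : delay i σ ∈ recordSet m i j i := h i (by omega)
    have h2 : delay i σ ∈ recordSet m i' j' i := h' i (by omega)
    rw [recordSet_first] at h1
    rw [recordSet_other m hi (by omega)] at h2
    exact absurd h2 (not_le.2 h1.1)

/-- The union of the events `recordEvent m i j`. -/
def twoRecords (m : ℕ) : Set (ℕ → shiftExample.Config) :=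
  ⋃ x ∈ recordIndices m, recordEvent m x.1 x.2

theorem measurableSet_twoRecords (m : ℕ) : MeasurableSet (twoRecords m) :=
  Finset.measurableSet_biUnion _ fun x _ => measurableSet_recordEvent m x.1 x.2

/-- There are m² disjoint events, which cancels the factor m^(-2). With m = 4l, Bernoulli's
inequality gives (1 - 2/m)^l ≥ 1/2, and 6m = 24l accounts for the exponent 24. -/
theorem le_runMeasure_twoRecords {l : ℕ} (hl : 1 ≤ l) :
    (((1 / 2) ^ 24 : ℝ≥0) : ℝ≥0∞) ≤ shiftExample.runMeasure (twoRecords (4 * l)) := by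
  set m := 4 * l with hm
  have hm0 : (m : ℝ≥0) ≠ 0 := by
    have : m ≠ 0 := by omega
    exact_mod_cast this
  rw [twoRecords, measure_biUnion_finset (fun x hx y hy hxy => disjoint_recordEvent hx hy hxy)
    fun x _ => measurableSet_recordEvent m x.1 x.2]
  have h1 : ∑ _x ∈ recordIndices m,
      (((1 / (m : ℝ≥0)) ^ 2 * (1 - 2 / (m : ℝ≥0)) ^ (6 * m) : ℝ≥0) : ℝ≥0∞) ≤
      ∑ x ∈ recordIndices m, shiftExample.runMeasure (recordEvent m x.1 x.2) := by
    refine Finset.sum_le_sum fun x hx => ?_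
    simp only [recordIndices, Finset.mem_product, Finset.mem_Ico] at hx
    exact le_runMeasure_recordEvent (by omega) (by omega) (by omega) (by omega)
  refine le_trans ?_ h1
  have hc : (recordIndices m).card = m * m := by
    rw [recordIndices, Finset.card_product, Nat.card_Ico, Nat.card_Ico]
    congr 1 <;> omega
  rw [Finset.sum_const, hc, nsmul_eq_mul, ← ENNReal.coe_natCast, ← ENNReal.coe_mul,
    ENNReal.coe_le_coe]
  have h2 : ((m * m : ℕ) : ℝ≥0) * ((1 / (m : ℝ≥0)) ^ 2 * (1 - 2 / (m : ℝ≥0)) ^ (6 * m)) =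
      (1 - 2 / (m : ℝ≥0)) ^ (6 * m) := by
    rw [← mul_assoc]
    push_cast
    field_simp
  have h3 : (1 / 2 : ℝ≥0) ≤ (1 - 2 / (m : ℝ≥0)) ^ l := by
    have hl0 : (0 : ℝ) < l := by exact_mod_cast hl
    have hle : 2 / (m : ℝ≥0) ≤ 1 := by
      rw [div_le_one (pos_of_ne_zero hm0)]
      exact_mod_cast (by omega : 2 ≤ m)
    have hb := one_add_mul_le_pow (a := -(2 / (m : ℝ))) (by
      have : 2 / (m : ℝ) ≤ 1 := by simpa using NNReal.coe_le_coe.2 hle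
      linarith) l
    rw [← NNReal.coe_le_coe]
    push_cast [NNReal.coe_sub hle]
    have he : (1 : ℝ) + l * -(2 / (m : ℝ)) = 1 / 2 := by
      rw [hm]
      push_cast
      field_simp
      norm_num
    rw [he, ← sub_eq_add_neg] at hb
    exact hb
  rw [h2, show 6 * m = l * 24 by omega, pow_mul]
  gcongr

/-- The tail unions decrease and each has measure at least 2^(-24), so continuity from above
suffices; no independence between different scales is needed. -/
theorem runMeasure_frequently_twoRecords_pos :
    0 < shiftExample.runMeasure (⋂ N : ℕ, ⋃ l ≥ N, twoRecords (4 * l)) := by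
  have hanti : Antitone fun N : ℕ => ⋃ l ≥ N, twoRecords (4 * l) := fun N M h =>
    biUnion_mono (fun l hl => h.trans hl) fun _ _ => le_rfl
  have ht := tendsto_measure_iInter_atTop (μ := shiftExample.runMeasure)
    (s := fun N : ℕ => ⋃ l ≥ N, twoRecords (4 * l))
    (fun N => (MeasurableSet.biUnion (to_countable _) fun l _ =>
      measurableSet_twoRecords (4 * l)).nullMeasurableSet) hanti ⟨0, measure_ne_top _ _⟩
  refine lt_of_lt_of_le (b := (((1 / 2) ^ 24 : ℝ≥0) : ℝ≥0∞)) (by simp) (ge_of_tendsto' ht fun N => ?_)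
  refine (le_runMeasure_twoRecords (l := N + 1) (by omega)).trans (measure_mono ?_)
  exact subset_biUnion_of_mem (u := fun l => twoRecords (4 * l)) (show N ≤ N + 1 by omega)

/-! ### From records to long blocks of constant bit -/

/-- A run of regular transitions whose state at the beginning of the round `k` is
`ready (bit k)`. -/
structure RegularWith (bit : ℕ → Bool) (σ : ℕ → shiftExample.Config) : Prop
    extends Regular σ where
  ready_bit : ∀ k, (σ (3 * k + 2)).state = ready (bit k)

theorem Regular.exists_regularWith {σ : ℕ → shiftExample.Config} (hσ : Regular σ) :
    ∃ bit, RegularWith bit σ := by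
  choose bit h using hσ.exists_ready
  exact ⟨bit, hσ, h⟩

namespace RegularWith

variable {bit : ℕ → Bool} {σ : ℕ → shiftExample.Config}

theorem bit_succ (h : RegularWith bit σ) (k : ℕ) :
    (bit (k + 1) = bit k ∧ delay (k + 1) σ + (σ (3 * k + 2)).age 1 < 2 ∧
      (σ (3 * (k + 1) + 2)).age 1 = (σ (3 * k + 2)).age 1) ∨
    (bit (k + 1) = !bit k ∧ 2 < delay (k + 1) σ + (σ (3 * k + 2)).age 1 ∧
      (σ (3 * (k + 1) + 2)).age 1 + delay (k + 1) σ = 2) := by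
  have hn : (σ (3 * k + 5)).state = ready (bit (k + 1)) := h.ready_bit (k + 1)
  rcases (h.round (h.ready_bit k)).1 with ⟨-, -, h1, h2, h3⟩ | ⟨-, -, h1, h2, h3⟩
  · exact Or.inl ⟨ready_injective (hn.symm.trans h1), h2, h3⟩
  · exact Or.inr ⟨ready_injective (hn.symm.trans h1), h2, h3⟩

theorem bit_zero (h : RegularWith bit σ) : bit 0 = false :=
  ready_injective ((h.ready_bit 0).symm.trans h.start.2.1)

theorem state_busy (h : RegularWith bit σ) (k : ℕ) : (σ (3 * k + 1)).state = busy (bit k) := by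
  cases k with
  | zero => rw [h.bit_zero]; exact h.start.1
  | succ k =>
    have hn : (σ (3 * k + 5)).state = ready (bit (k + 1)) := h.ready_bit (k + 1)
    change (σ (3 * k + 4)).state = busy (bit (k + 1))
    rcases (h.round (h.ready_bit k)).1 with ⟨-, h0, h1, -⟩ | ⟨-, h0, h1, -⟩ <;>
      rw [h0, ready_injective (hn.symm.trans h1)]

/-- With p = 1/m and q = 2/m, the shift is at least q before round i, lies in [p, q) from i to j -
1, and is below p from j on. The remaining delays have 2 - X ≥ q and cannot lower a shift below q,
so from round i up to 6m the flips are exactly those at i and j. Flips before i are not restricted.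
-/
theorem bit_of_mem_recordEvent (h : RegularWith bit σ) {m i j : ℕ} (hi : 0 < i) (hij : i < j)
    (hj : j ≤ 6 * m) (hσ : σ ∈ recordEvent m i j) :
    bit (i - 1) = !bit i ∧ (∀ k, i ≤ k → k < j → bit k = bit i) ∧
      ∀ k, j ≤ k → k ≤ 6 * m → bit k = !bit i := by
  have hm : (1 : ℝ≥0) ≤ m := by exact_mod_cast (by omega : 1 ≤ m)
  have hq2 : 2 / (m : ℝ≥0) ≤ 2 := div_le_self zero_le hm
  have hp2 : 1 / (m : ℝ≥0) ≤ 2 := (div_le_self zero_le hm).trans one_le_two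
  have hfirst : 2 < delay i σ + 2 / (m : ℝ≥0) ∧ delay i σ + 1 / (m : ℝ≥0) ≤ 2 := by
    have := hσ i (by omega)
    rw [recordSet_first] at this
    exact ⟨(tsub_lt_iff_right hq2).1 this.1, (le_tsub_iff_right hp2).1 this.2⟩
  have hsecond : 2 < delay j σ + 1 / (m : ℝ≥0) := by
    have := hσ j (by omega)
    rw [recordSet_second m (by omega)] at this
    exact (tsub_lt_iff_right hp2).1 this.1
  have hother : ∀ k ≤ 6 * m, k ≠ i → k ≠ j → delay k σ + 2 / (m : ℝ≥0) ≤ 2 := by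
    intro k hk hki hkj
    have := hσ k hk
    rw [recordSet_other m hki hkj] at this
    exact (le_tsub_iff_right hq2).1 this
  set p := 1 / (m : ℝ≥0)
  set q := 2 / (m : ℝ≥0)
  have hpq : p ≤ q := by
    simp only [p, q]
    gcongr
    exact one_le_two
  have h1 : ∀ k < i, q ≤ (σ (3 * k + 2)).age 1 := by
    intro k
    induction k with
    | zero =>
      intro _
      have := hother 0 (by omega) (by omega) (by omega)
      have := h.start.2.2
      simp only [Nat.mul_zero, Nat.zero_add]
      grind
    | succ k ih =>
      intro hk
      have h0 := hother (k + 1) (by omega) (by omega) (by omega)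
      have ih := ih (by omega)
      rcases h.bit_succ k with ⟨-, -, h3⟩ | ⟨-, -, h3⟩
      · rw [h3]; exact ih
      · grind
  obtain ⟨i, rfl⟩ : ∃ i', i = i' + 1 := ⟨i - 1, by omega⟩
  have h2 : bit (i + 1) = !bit i ∧ (σ (3 * (i + 1) + 2)).age 1 + delay (i + 1) σ = 2 := by
    have := h1 i (by omega)
    rcases h.bit_succ i with ⟨-, h3, -⟩ | ⟨h3, -, h4⟩
    · grind
    · exact ⟨h3, h4⟩
  have h3 : ∀ k, i + 1 ≤ k → k < j →
      bit k = bit (i + 1) ∧ p ≤ (σ (3 * k + 2)).age 1 ∧ (σ (3 * k + 2)).age 1 < q := by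
    intro k hk
    induction k, hk using Nat.le_induction with
    | base => exact fun _ => ⟨rfl, by grind, by grind⟩
    | succ k hk ih =>
      intro hkj
      have h0 := hother (k + 1) (by omega) (by omega) (by omega)
      obtain ⟨ih1, ih2, ih3⟩ := ih (by omega)
      rcases h.bit_succ k with ⟨h4, -, h5⟩ | ⟨-, h4, -⟩
      · rw [h4, h5]; exact ⟨ih1, ih2, ih3⟩
      · grind
  obtain ⟨j, rfl⟩ : ∃ j', j = j' + 1 := ⟨j - 1, by omega⟩
  have h4 : ∀ k, j + 1 ≤ k → k ≤ 6 * m →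
      bit k = !bit (i + 1) ∧ (σ (3 * k + 2)).age 1 < p := by
    intro k hk
    induction k, hk using Nat.le_induction with
    | base =>
      intro _
      obtain ⟨ih1, ih2, ih3⟩ := h3 j (by omega) (by omega)
      rcases h.bit_succ j with ⟨-, h4, -⟩ | ⟨h4, -, h5⟩
      · grind
      · rw [h4, ih1]
        exact ⟨rfl, by grind⟩
    | succ k hk ih =>
      intro hkm
      have h0 := hother (k + 1) (by omega) (by omega) (by omega)
      obtain ⟨ih1, ih2⟩ := ih (by omega)
      rcases h.bit_succ k with ⟨h4, -, h5⟩ | ⟨-, h4, -⟩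
      · rw [h4, h5]; exact ⟨ih1, ih2⟩
      · grind
  exact ⟨by simp [h2.1], fun k hk hkj => (h3 k hk hkj).1, fun k hk hkm => (h4 k hk hkm).1⟩

end RegularWith

/-- Infinitely often, a maximal block of rounds with the bit `c` lasts half as long as everything
that precedes it. -/
def LongBlocks (bit : ℕ → Bool) (c : Bool) : Prop :=
  ∀ N, ∃ p q, N ≤ p ∧ 3 * p ≤ 2 * q ∧ 1 ≤ p ∧ bit (p - 1) = !c ∧ ∀ k, p ≤ k → k ≤ q → bit k = c

/-- The blocks [i, j - 1] and [j, 6m] carry opposite bits, so one of them has the bit c. The ratio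
3/2 comes from i < 2m, 3m ≤ j and j < 4m. -/
theorem RegularWith.longBlocks {bit : ℕ → Bool} {σ : ℕ → shiftExample.Config}
    (h : RegularWith bit σ) (hσ : ∀ N, ∃ l ≥ N, σ ∈ twoRecords (4 * l)) (c : Bool) :
    LongBlocks bit c := by
  intro N
  obtain ⟨l, hl, hx⟩ := hσ (N + 1)
  simp only [twoRecords, mem_iUnion, recordIndices, Finset.mem_product, Finset.mem_Ico] at hx
  obtain ⟨⟨i, j⟩, ⟨⟨hi1, hi2⟩, hj1, hj2⟩, hx⟩ := hx
  simp only at hi1 hi2 hj1 hj2 hx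
  obtain ⟨h1, h2, h3⟩ := h.bit_of_mem_recordEvent (by omega) (by omega) (by omega) hx
  by_cases hc : bit i = c
  · refine ⟨i, j - 1, by omega, by omega, by omega, by rw [h1, hc], fun k hk hkj => ?_⟩
    rw [h2 k hk (by omega), hc]
  · have hc' : (!bit i) = c := by rw [← Bool.not_eq_not, Bool.not_not] at *; simpa using hc
    refine ⟨j, 6 * (4 * l), by omega, by omega, by omega, ?_, fun k hk hkm => ?_⟩
    · rw [h2 (j - 1) (by omega) (by omega), ← hc', Bool.not_not]
    · rw [h3 k hk hkm, hc']

/-! ### Long phases -/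

/-- The states of one half of the example. -/
def half (c : Bool) : Set (Fin 7) := cond c {0, 1, 2} {0, 1, 2}ᶜ

theorem ready_mem_half (b c : Bool) : ready b ∈ half c ↔ b = c := by
  cases b <;> cases c <;> simp [half, ready]

theorem busy_mem_half (b c : Bool) : busy b ∈ half c ↔ b = c := by
  cases b <;> cases c <;> simp [half, busy]

theorem waiting_mem_half (b c : Bool) : waiting b ∈ half c ↔ b = c := by
  cases b <;> cases c <;> simp [half, waiting]

namespace RegularWith

variable {bit : ℕ → Bool} {σ : ℕ → shiftExample.Config}

/-- The three steps are grouped from 3k+1 on, not from 3k+2, because the last `busy` configuration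
before a round already carries the bit of that round. -/
theorem state_mem_half (h : RegularWith bit σ) (c : Bool) (k : ℕ) :
    ((σ (3 * k + 1)).state ∈ half c ↔ bit k = c) ∧ ((σ (3 * k + 2)).state ∈ half c ↔ bit k = c) ∧
      ((σ (3 * k + 3)).state ∈ half c ↔ bit k = c) := by
  refine ⟨?_, ?_, ?_⟩
  · rw [h.state_busy, busy_mem_half]
  · rw [h.ready_bit, ready_mem_half]
  · rcases (h.round (h.ready_bit k)).1 with h | h
    · rw [h.1, busy_mem_half]
    · rw [h.1, waiting_mem_half]

theorem infinitelyManyLongPhases (h : RegularWith bit σ) (hb : ∀ c, LongBlocks bit c) (c : Bool) :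
    InfinitelyManyLongPhases (half c) (1 / 2) σ := by
  classical
  intro N
  obtain ⟨p, q, hp, hpq, hp1, hpc, hq⟩ := hb c N
  -- The block supplied need not be maximal on the right. It is finite, since blocks of the opposite
  -- bit recur, and the phase is taken up to the first flip r.
  have hex : ∃ k, p ≤ k ∧ bit k ≠ c := by
    obtain ⟨p', q', hp', hpq', -, -, hq'⟩ := hb (!c) p
    exact ⟨p', hp', by rw [hq' p' le_rfl (by omega)]; simp⟩
  obtain ⟨hr1, hr2⟩ := Nat.find_spec hex
  set r := Nat.find hex with hr
  have hrq : q < r := by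
    by_contra hn
    exact hr2 (hq r hr1 (by omega))
  have hmin : ∀ k, p ≤ k → k < r → bit k = c := by
    intro k hk hkr
    by_contra hn
    exact Nat.find_min hex hkr ⟨hk, hn⟩
  refine ⟨3 * p + 1, 3 * r + 1, by omega, ⟨by omega, fun n hn1 hn2 => ?_, ?_, fun n hn => ?_⟩, ?_⟩
  · obtain ⟨k, hk⟩ : ∃ k, n = 3 * k + 1 ∨ n = 3 * k + 2 ∨ n = 3 * k + 3 := ⟨(n - 1) / 3, by omega⟩
    have hbit := hmin k (by omega) (by omega)
    obtain ⟨e1, e2, e3⟩ := h.state_mem_half c k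
    rcases hk with rfl | rfl | rfl
    exacts [e1.2 hbit, e2.2 hbit, e3.2 hbit]
  · exact fun hm => hr2 ((h.state_mem_half c r).1.1 hm)
  · obtain rfl : n = 3 * (p - 1) + 3 := by omega
    rw [(h.state_mem_half c (p - 1)).2.2, hpc]
    simp
  · have h1 : (3 * p : ℝ) ≤ 2 * q := by exact_mod_cast hpq
    have h2 : (q + 1 : ℝ) ≤ r := by exact_mod_cast hrq
    push_cast
    linarith

end RegularWith

/-! ### Divergence of the frequencies -/

/-- A sequence that is constant on infinitely many long blocks, and grows with slope at least one
on infinitely many others, has no asymptotic slope. -/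
theorem not_tendsto_div_of_blocks {F : ℕ → ℝ}
    (hA : ∀ M : ℕ, ∃ p q, M ≤ p ∧ 3 * p ≤ 2 * q ∧ (q : ℝ) - p ≤ F q - F p)
    (hB : ∀ M : ℕ, ∃ p q, M ≤ p ∧ 3 * p ≤ 2 * q ∧ F q = F p) (r : ℝ) :
    ¬ Tendsto (fun k : ℕ => F k / k) atTop (𝓝 r) := by
  intro h
  -- From 3p ≤ 2q follows p + q ≤ 5(q - p), so errors p/20 and q/20 at the ends of a block change
  -- its mean slope by at most 1/4. Flat blocks then give r ≤ 1/4, steep ones r ≥ 3/4.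
  obtain ⟨M, hM⟩ := Metric.tendsto_atTop.1 h (1 / 20) (by norm_num)
  have key : ∀ k : ℕ, M + 1 ≤ k → |F k - r * k| ≤ k / 20 := by
    intro k hk
    have hk0 : (0 : ℝ) < k := by exact_mod_cast (by omega : 0 < k)
    have h1 := (hM k (by omega)).le
    rw [Real.dist_eq] at h1
    have h2 : F k - r * k = (F k / k - r) * k := by field_simp
    rw [h2, abs_mul, abs_of_pos hk0]
    calc |F k / k - r| * k ≤ 1 / 20 * k := by gcongr
      _ = k / 20 := by ring
  obtain ⟨p, q, hp, hpq, hF⟩ := hB (M + 1)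
  obtain ⟨p', q', hp', hpq', hF'⟩ := hA (M + 1)
  have h1 := abs_le.1 (key p hp)
  have h2 := abs_le.1 (key q (by omega))
  have h3 := abs_le.1 (key p' hp')
  have h4 := abs_le.1 (key q' (by omega))
  have e1 : (3 * p : ℝ) ≤ 2 * q := by exact_mod_cast hpq
  have e2 : (3 * p' : ℝ) ≤ 2 * q' := by exact_mod_cast hpq'
  have e3 : (0 : ℝ) < p := by exact_mod_cast (by omega : 0 < p)
  have e4 : (0 : ℝ) < p' := by exact_mod_cast (by omega : 0 < p')
  have hr1 : r ≤ 1 / 4 := by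
    by_contra hn
    nlinarith [mul_pos (by linarith : 0 < (q : ℝ) - p) (by linarith : 0 < r - 1 / 4)]
  nlinarith [mul_nonneg (by linarith : 0 ≤ (q' : ℝ) - p') (by linarith : 0 ≤ 1 / 4 - r)]

/-- Along the indices 3k+1 both frequencies have a denominator affine in the number k of rounds:
3k+1 steps, or a constant plus 2k time units. Convergence of a frequency would thus give an
asymptotic slope per round. -/
theorem tendsto_div_of_tendsto_div_affine {F D : ℕ → ℝ} {u v r : ℝ} (hv : 0 < v)
    (hD : ∀ k, D k = u + v * k) (h : Tendsto (fun k => F k / D k) atTop (𝓝 r)) :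
    Tendsto (fun k : ℕ => F k / k) atTop (𝓝 (r * v)) := by
  have h1 : Tendsto (fun k : ℕ => D k / k) atTop (𝓝 v) := by
    have h2 : Tendsto (fun k : ℕ => u / (k : ℝ) + v) atTop (𝓝 (0 + v)) :=
      (tendsto_const_div_atTop_nhds_zero_nat u).add tendsto_const_nhds
    rw [zero_add] at h2
    refine h2.congr' ?_
    filter_upwards [eventually_gt_atTop 0] with k hk
    have : (k : ℝ) ≠ 0 := by exact_mod_cast hk.ne'
    rw [hD]
    field_simp
  refine (h.mul h1).congr' ?_
  filter_upwards [h1.eventually_ne hv.ne'] with k hk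
  have : D k ≠ 0 := fun h0 => hk (by rw [h0, zero_div])
  field_simp

namespace RegularWith

variable {bit : ℕ → Bool} {σ : ℕ → shiftExample.Config}

/-- The accumulated weight of the set `K` of states has no asymptotic slope. -/
theorem not_tendsto_sum_div (h : RegularWith bit σ) (hb : ∀ c, LongBlocks bit c)
    {K : Set (Fin 7)} (h0 : ready true ∈ K) (hK : K ⊆ half true) {w : ℕ → ℝ} (hw : ∀ i, 0 ≤ w i)
    (hw1 : ∀ k, 1 ≤ w (3 * k + 2)) (r : ℝ) :
    ¬ Tendsto (fun k : ℕ => (∑ i ∈ Finset.range (3 * k + 2),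
      K.indicator (fun _ => (1 : ℝ)) (σ i).state * w i) / k) atTop (𝓝 r) := by
  set f : ℕ → ℝ := fun i => K.indicator (fun _ => (1 : ℝ)) (σ i).state * w i with hf
  set F : ℕ → ℝ := fun k => ∑ i ∈ Finset.range (3 * k + 2), f i with hF
  have hf0 : ∀ i, 0 ≤ f i := fun i =>
    mul_nonneg (indicator_nonneg (fun _ _ => zero_le_one) _) (hw i)
  have hsucc : ∀ k, F (k + 1) = F k + f (3 * k + 2) + f (3 * k + 3) + f (3 * k + 4) := by
    intro k
    simp only [hF]
    rw [show 3 * (k + 1) + 2 = 3 * k + 2 + 1 + 1 + 1 by ring, Finset.sum_range_succ,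
      Finset.sum_range_succ, Finset.sum_range_succ]
  have htrue : ∀ k, bit k = true → F k + 1 ≤ F (k + 1) := by
    intro k hk
    have h1 : f (3 * k + 2) = w (3 * k + 2) := by
      simp only [hf]
      rw [h.ready_bit, hk, indicator_of_mem h0, one_mul]
    rw [hsucc, h1]
    linarith [hw1 k, hf0 (3 * k + 3), hf0 (3 * k + 4)]
  have hz : ∀ i, (σ i).state ∉ half true → f i = 0 := fun i hi => by
    simp only [hf]
    rw [indicator_of_notMem fun hi' => hi (hK hi'), zero_mul]
  -- The increment runs over the steps 3k+2 to 3k+4, and the last of these carries the bit of round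
  -- k+1; hence both bits must be false.
  have hfalse : ∀ k, bit k = false → bit (k + 1) = false → F (k + 1) = F k := by
    intro k hk hk1
    obtain ⟨-, e2, e3⟩ := h.state_mem_half true k
    obtain ⟨e1, -, -⟩ := h.state_mem_half true (k + 1)
    rw [hsucc, hz _ (by rw [e2, hk]; simp), hz _ (by rw [e3, hk]; simp),
      hz (3 * k + 4) (by change ¬ (σ (3 * (k + 1) + 1)).state ∈ _; rw [e1, hk1]; simp)]
    ring
  refine not_tendsto_div_of_blocks (F := F) (fun M => ?_) (fun M => ?_) r
  · obtain ⟨p, q, hp, hpq, hp1, -, hq⟩ := hb true M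
    refine ⟨p, q, hp, hpq, ?_⟩
    have key : ∀ k, p ≤ k → k ≤ q → (k : ℝ) - p ≤ F k - F p := by
      intro k hk
      induction k, hk using Nat.le_induction with
      | base => intro _; simp
      | succ k hk ih =>
        intro hkq
        have h1 := ih (by omega)
        have h2 := htrue k (hq k hk (by omega))
        push_cast
        linarith
    exact key q (by omega) le_rfl
  · obtain ⟨p, q, hp, hpq, hp1, -, hq⟩ := hb false M
    refine ⟨p, q, hp, hpq, ?_⟩
    have key : ∀ k, p ≤ k → k ≤ q → F k = F p := by
      intro k hk
      induction k, hk using Nat.le_induction with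
      | base => exact fun _ => rfl
      | succ k hk ih =>
        intro hkq
        rw [hfalse k (hq k hk (by omega)) (hq (k + 1) (by omega) hkq), ih (by omega)]
    exact key q (by omega) le_rfl

theorem not_discreteFreqDefined (h : RegularWith bit σ) (hb : ∀ c, LongBlocks bit c)
    {K : Set (Fin 7)} (h0 : ready true ∈ K) (hK : K ⊆ half true) :
    ¬ DiscreteFreqDefined K σ := by
  rintro ⟨r, hr⟩
  have hsub : Tendsto (fun k : ℕ => 3 * k + 1) atTop atTop :=
    tendsto_atTop_mono (fun k => by simp only [id]; omega) tendsto_id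
  refine h.not_tendsto_sum_div hb h0 hK (w := fun _ => 1) (fun _ => zero_le_one)
    (fun _ => le_rfl) (r * 3) ?_
  refine tendsto_div_of_tendsto_div_affine (D := fun k => ((3 * k + 1 : ℕ) : ℝ)) (u := 1)
    three_pos (fun k => by push_cast; ring) ?_
  simp only [mul_one]
  exact hr.comp hsub

theorem not_timedFreqDefined (h : RegularWith bit σ) (hb : ∀ c, LongBlocks bit c)
    {K : Set (Fin 7)} (h0 : ready true ∈ K) (hK : K ⊆ half true) :
    ¬ TimedFreqDefined K σ := by
  rintro ⟨r, hr⟩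
  have hsub : Tendsto (fun k : ℕ => 3 * k + 1) atTop atTop :=
    tendsto_atTop_mono (fun k => by simp only [id]; omega) tendsto_id
  set D : ℕ → ℝ := fun k => ∑ i ∈ Finset.range (3 * k + 2), ((σ (i + 1)).last : ℝ) with hD
  -- A round lasts exactly the delay 2 of event 0, whatever happens in it.
  have hDk : ∀ k, D k = D 0 + 2 * k := by
    intro k
    induction k with
    | zero => simp
    | succ k ih =>
      have h1 : ((σ (3 * k + 3)).last : ℝ) + (σ (3 * k + 4)).last + (σ (3 * k + 5)).last = 2 := by
        exact_mod_cast (h.round (h.ready_bit k)).2.2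
      have h2 : D (k + 1) = D k + (σ (3 * k + 3)).last + (σ (3 * k + 4)).last +
          (σ (3 * k + 5)).last := by
        simp only [hD]
        rw [show 3 * (k + 1) + 2 = 3 * k + 2 + 1 + 1 + 1 by ring, Finset.sum_range_succ,
          Finset.sum_range_succ, Finset.sum_range_succ]
      rw [h2, ih]
      push_cast
      linarith
  refine h.not_tendsto_sum_div hb h0 hK (w := fun i => ((σ (i + 1)).last : ℝ))
    (fun i => (σ (i + 1)).last.2)
    (fun k => by exact_mod_cast (h.round (h.ready_bit k)).2.1) (r * 2) ?_
  exact tendsto_div_of_tendsto_div_affine two_pos hDk (hr.comp hsub)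

end RegularWith

theorem shiftExample_isUniform : shiftExample.IsUniform 2 := by
  refine ⟨by simp [IsVariable, shiftExample], 2, by simp [shiftExample], fun x hx => ?_⟩
  have hx' : x ∈ Icc (1 : ℝ) 2 := by simpa [shiftExample] using hx
  have hl : shiftExample.lower 2 = 1 := rfl
  change (Icc (1 : ℝ) 2).indicator 1 x = _
  rw [indicator_of_mem hx', hl]
  norm_num

end GSMP

end


/-! ### Conclusion -/

open GSMP

theorem mainTheorem1 :
    ∃ (n : ℕ) (G : GSMP (Fin n) (Fin 3)) (H : Set (Fin n)),
      G.IsFixed 0 ∧ G.IsFixed 1 ∧ G.IsUniform 2 ∧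
      (∃ s ∈ H, ∃ α : ℝ, 0 < α ∧ ∃ R : Set (ℕ → G.Config),
        MeasurableSet R ∧ 0 < G.runMeasure R ∧ ∀ σ ∈ R,
          ¬ GSMP.DiscreteFreqDefined H σ ∧ ¬ GSMP.TimedFreqDefined H σ ∧
          ¬ GSMP.DiscreteFreqDefined {s} σ ∧ ¬ GSMP.TimedFreqDefined {s} σ ∧
          GSMP.InfinitelyManyLongPhases H α σ ∧ GSMP.InfinitelyManyLongPhases Hᶜ α σ) ∧
      ∀ π : Measure G.Config, IsProbabilityMeasure π → ¬ Kernel.Invariant G.step π := by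
  refine ⟨7, shiftExample, half true, rfl, rfl, shiftExample_isUniform,
    ⟨ready true, (ready_mem_half _ _).2 rfl, 1 / 2, by norm_num, ?_⟩,
    fun π hπ => not_invariant_shiftExample⟩
  set A := ⋂ N : ℕ, ⋃ l ≥ N, twoRecords (4 * l) with hA
  -- Removing a measurable null superset of the irregular runs keeps the witness set measurable
  -- without a proof that regularity is a measurable condition.
  set B := toMeasurable shiftExample.runMeasure {σ | ¬ Regular σ} with hB
  have hAm : MeasurableSet A := MeasurableSet.iInter fun N =>
    MeasurableSet.biUnion (to_countable _) fun l _ => measurableSet_twoRecords (4 * l)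
  have hB0 : shiftExample.runMeasure B = 0 := by
    rw [hB, measure_toMeasurable]
    exact ae_iff.1 ae_regular
  refine ⟨A \ B, hAm.diff (measurableSet_toMeasurable _ _), ?_, fun σ hσ => ?_⟩
  · rw [measure_sdiff_null hB0]
    exact runMeasure_frequently_twoRecords_pos
  · have hreg : Regular σ := by
      by_contra hn
      exact hσ.2 (subset_toMeasurable _ _ hn)
    obtain ⟨bit, h⟩ := hreg.exists_regularWith
    have hb : ∀ c, LongBlocks bit c := h.longBlocks fun N => by
      simpa using mem_iInter.1 hσ.1 N
    have hsub : {ready true} ⊆ half true :=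
      singleton_subset_iff.2 ((ready_mem_half _ _).2 rfl)
    have hr : ready true ∈ half true := (ready_mem_half _ _).2 rfl
    have hc : (half true)ᶜ = half false := rfl
    exact ⟨h.not_discreteFreqDefined hb hr le_rfl, h.not_timedFreqDefined hb hr le_rfl,
      h.not_discreteFreqDefined hb rfl hsub, h.not_timedFreqDefined hb rfl hsub,
      h.infinitelyManyLongPhases hb true, hc ▸ h.infinitelyManyLongPhases hb false⟩
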